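/- Let $\mathscr H$ be a complex Hilbert space and let $\mathbb B(\mathscr H)_+$ be the cone of positive bounded operators on $\mathscr H$, with the Loewner order $\le$. An operator mean is a binary operation $\sigma$ on $\mathbb B(\mathscr H)_+$ such that (i) $I\sigma I=I$; (ii) $C^*(A\sigma B)C\le (C^*AC)\sigma(C^*BC)$ for all bounded $C$; (iii) $A_n\downarrow A$ and $B_n\downarrow B$ imply $A_n\sigma B_n\downarrow A\sigma B$ (decreasing sequences converging in the strong operator topology); (iv) $A\le B$ and $C\le D$ imply $A\sigma C\le B\sigma D$; where, if $\mathscr H$ is finite-dimensional, it is moreover understood (as in the Kubo–Ando correspondence) that the representing function $f$ of $\sigma$, given by $f(t)I=I\sigma(tI)$ for $t\ge 0$, is operator monotone on $[0,\infty)$, i.e. $0\le S\le T$ implies $f(S)\le f(T)$ for complex matrices of every size. For invertible positive operators $A,B$ put $$A\sharp B=A^{1/2}(A^{-1/2}BA^{-1/2})^{1/2}A^{1/2},\qquad A\sigma^{\perp}B=A^{1/2}\,g(A^{-1/2}BA^{-1/2})\,A^{1/2},\quad g(t)=t/f(t),$$ where $f$ is the representing function of $\sigma$; $\sigma^\perp$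 is called the dual of $\sigma$. Let $A_1,\dots,A_m,B_1,\dots,B_m$ be invertible positive operators on $\mathscr H$ and let $\sigma$ be an operator mean. Then $$\sum_{j=1}^m (A_j\sharp B_j)\le\Big(\sum_{j=1}^m A_j\sigma B_j\Big)\sharp\Big(\sum_{j=1}^m A_j\sigma^{\perp}B_j\Big)\le\Big(\sum_{j=1}^m A_j\Big)\sharp\Big(\sum_{j=1}^m B_j\Big).$$ Furthermore, let $A\sigma B=B\sigma A$ for all invertible positive $A,B$, and let $(\sigma_t)_{t\in[0,1]}$ be an interpolational path for $\sigma$, that is, a family of operator means such that for all invertible positive $A,B$: $A\sigma_0B=A$, $A\sigma_{1/2}B=A\sigma B$, $A\sigma_1B=B$; $(A\sigma_pB)\sigma(A\sigma_qB)=A\sigma_{(p+q)/2}B$ for all $p,q\in[0,1]$; and $t\mapsto A\sigma_tB$ is norm continuous on $[0,1]$. If $A\sigma_t^{\perp}B=A\sigma_{1-t}B$ for all $t\in[0,1]$ and all invertible positive $A,B$, then for every $t\in[0,1]$ and every $s$ between $t$ and $1-t$ (inclusive, in either order) $$\Big(\sum_{j=1}^m A_j\sigma_sB_j\Big)\sharp\Big(\sum_{j=1}^m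 A_j\sigma_{1-s}B_j\Big)\le\Big(\sum_{j=1}^m A_j\sigma_tB_j\Big)\sharp\Big(\sum_{j=1}^m A_j\sigma_{1-t}B_j\Big).$$ -/

import Mathlib

open Filter Topology Set

section OperatorMeans

variable {H : Type*} [NormedAddCommGroup H] [InnerProductSpace ℂ H] [CompleteSpace H]

/-- `T n ↓ S`: the sequence is decreasing for the Loewner order and converges to `S` in the
strong operator topology. -/
def DecreasesTo (T : ℕ → H →L[ℂ] H) (S : H →L[ℂ] H) : Prop :=
  Antitone T ∧ ∀ x : H, Tendsto (fun n => T n x) atTop (𝓝 (S x))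

/-- The representing function `f` of a binary operation `σ` on positive operators: for `t ≥ 0`,
`f t` is the real number with `f t • 1 = 1 σ (t • 1)`. -/
noncomputable def representingFunction
    (σ : (H →L[ℂ] H) → (H →L[ℂ] H) → (H →L[ℂ] H)) (t : ℝ) : ℝ :=
  Classical.epsilon fun c : ℝ => σ 1 ((t : ℂ) • 1) = (c : ℂ) • 1

/-- `f` is monotone on the positive bounded operators on `K`: `0 ≤ S ≤ T` implies
`f(S) ≤ f(T)`. -/
def IsMonotoneOnOperators (K : Type*) [NormedAddCommGroup K] [InnerProductSpace ℂ K]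
    [CompleteSpace K] (f : ℝ → ℝ) : Prop :=
  ∀ S T : K →L[ℂ] K, 0 ≤ S → S ≤ T → cfc f S ≤ cfc f T

/-- `f` is operator monotone on `[0, ∞)`: `0 ≤ S ≤ T` implies `f(S) ≤ f(T)` for complex matrices
(operators on `ℂⁿ`) of every size `n`. -/
def IsOperatorMonotone (f : ℝ → ℝ) : Prop :=
  ∀ n : ℕ, IsMonotoneOnOperators (EuclideanSpace ℂ (Fin n)) f

/-- Operator means in the sense of Kubo and Ando, as binary operations on the cone of positive
bounded operators on `H` (the values of `σ` outside of the cone play no role).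

The Kubo-Ando correspondence between operator means and operator monotone functions is a theorem
about the four axioms when `H` is infinite-dimensional.  On a fixed finite-dimensional space
the axioms only see matrices of bounded size, and "operator mean" means there that the representing
function is operator monotone, i.e. monotone on matrices of all sizes. -/
structure IsOperatorMean (σ : (H →L[ℂ] H) → (H →L[ℂ] H) → (H →L[ℂ] H)) : Prop where
  nonneg : ∀ A B : H →L[ℂ] H, 0 ≤ A → 0 ≤ B → 0 ≤ σ A B
  one_one : σ 1 1 = 1
  transformer : ∀ A B C : H →L[ℂ] H, 0 ≤ A → 0 ≤ B →
    star C * σ A B * C ≤ σ (star C * A * C) (star C * B * C)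
  decreasing : ∀ (A' B' : ℕ → H →L[ℂ] H) (A B : H →L[ℂ] H),
    (∀ n, 0 ≤ A' n) → (∀ n, 0 ≤ B' n) → DecreasesTo A' A → DecreasesTo B' B →
      DecreasesTo (fun n => σ (A' n) (B' n)) (σ A B)
  mono : ∀ A B C D : H →L[ℂ] H, 0 ≤ A → 0 ≤ C → A ≤ B → C ≤ D → σ A C ≤ σ B D
  operatorMonotone_of_finiteDimensional :
    FiniteDimensional ℂ H → ∃ f : ℝ → ℝ, IsOperatorMonotone f ∧
      ∀ t : ℝ, 0 ≤ t → σ 1 ((t : ℂ) • 1) = (f t : ℂ) • 1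

/-- The operation `(A, B) ↦ A^{1/2} g(A^{-1/2} B A^{-1/2}) A^{1/2}` on invertible positive
operators. -/
noncomputable def meanOfFunction (g : ℝ → ℝ) (A B : H →L[ℂ] H) : H →L[ℂ] H :=
  A ^ (1 / 2 : ℝ) * cfc g (A ^ (-(1 / 2) : ℝ) * B * A ^ (-(1 / 2) : ℝ)) * A ^ (1 / 2 : ℝ)

/-- The dual `A σ^⊥ B` of an operator mean, for invertible positive `A` and `B`: the operation with
representing function `t / f(t)`, where `f` is the representing function of `σ`. -/
noncomputable def dualMean (σ : (H →L[ℂ] H) → (H →L[ℂ] H) → (H →L[ℂ] H)) :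
    (H →L[ℂ] H) → (H →L[ℂ] H) → (H →L[ℂ] H) :=
  meanOfFunction fun t => t / representingFunction σ t

/-- The geometric mean `A ♯ B = A^{1/2} (A^{-1/2} B A^{-1/2})^{1/2} A^{1/2}` of invertible positive
operators. -/
noncomputable def geometricMean (A B : H →L[ℂ] H) : H →L[ℂ] H :=
  A ^ (1 / 2 : ℝ) * (A ^ (-(1 / 2) : ℝ) * B * A ^ (-(1 / 2) : ℝ)) ^ (1 / 2 : ℝ) * A ^ (1 / 2 : ℝ)

/-- `τ t`, `t ∈ [0, 1]`, is an interpolational path for the symmetric operator mean `σ`; the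
identities and the norm continuity are about invertible positive operators. -/
structure IsInterpolationalPath (σ : (H →L[ℂ] H) → (H →L[ℂ] H) → (H →L[ℂ] H))
    (τ : ℝ → (H →L[ℂ] H) → (H →L[ℂ] H) → (H →L[ℂ] H)) : Prop where
  symmetric : ∀ A B : H →L[ℂ] H, IsStrictlyPositive A → IsStrictlyPositive B → σ A B = σ B A
  isOperatorMean : ∀ t ∈ Icc (0 : ℝ) 1, IsOperatorMean (τ t)
  zero : ∀ A B : H →L[ℂ] H, IsStrictlyPositive A → IsStrictlyPositive B → τ 0 A B = A
  half : ∀ A B : H →L[ℂ] H, IsStrictlyPositive A → IsStrictlyPositive B → τ (1 / 2) A B = σ A B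
  one : ∀ A B : H →L[ℂ] H, IsStrictlyPositive A → IsStrictlyPositive B → τ 1 A B = B
  midpoint : ∀ A B : H →L[ℂ] H, IsStrictlyPositive A → IsStrictlyPositive B →
    ∀ p ∈ Icc (0 : ℝ) 1, ∀ q ∈ Icc (0 : ℝ) 1, σ (τ p A B) (τ q A B) = τ ((p + q) / 2) A B
  continuousOn : ∀ A B : H →L[ℂ] H, IsStrictlyPositive A → IsStrictlyPositive B →
    ContinuousOn (fun t => τ t A B) (Icc (0 : ℝ) 1)

end OperatorMeans

/-!
The mean `σ` is determined by its representing function `f` through the Kubo–Ando formula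
`A σ B = A^{1/2} f(A^{-1/2} B A^{-1/2}) A^{1/2}` (`IsOperatorMean.eq_meanOfFunction`). Two facts about
means of this form give the two inequalities.

* `(A σ B) ♯ (A σ^⊥ B) = A ♯ B` (`geometricMean_meanOfFunction`), because `A ♯ B` is the only positive
  solution `G` of the Riccati equation `G A⁻¹ G = B`.
* If `f` is operator monotone, then `σ` is superadditive (`meanOfFunction_add_le`), that is,
  `∑ A_j σ B_j ≤ (∑ A_j) σ (∑ B_j)`. This applies to `♯`, to `σ`, and also to `σ^⊥`, as `t / f(t)` is
  operator monotone together with `f` (`IsMonotoneOnStrictlyPositive.id_div`).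

Superadditivity of `♯` at the operators `A_j σ B_j`, `A_j σ^⊥ B_j` is the first inequality; the second
one follows from superadditivity of `σ` and `σ^⊥` and from `♯` being monotone in both variables.

Superadditivity and the monotonicity of `t / f(t)` both come from Jensen's operator inequality
`C* f(X) C + D* f(Y) D ≤ f(C* X C + D* Y D)` for `C* C + D* D = 1` (`star_conj_cfc_add_le`), which on `H`
needs monotonicity of `f` on a space `K` that contains two orthogonal copies of `H`. If `H` is
infinite-dimensional, `K = H` will do; otherwise `K` is a Euclidean space, on which monotonicity is
part of the definition of an operator mean.

For the last claim, the midpoint identity and continuity give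
`(A σ_t B) σ_r (A σ_{1-t} B) = A σ_s B` with `s = (1 - r) t + r (1 - t)` (`IsInterpolationalPath.reparam`),
and the second inequality applied to the operators `A_j σ_t B_j`, `A_j σ_{1-t} B_j` and the mean `σ_r`
is the assertion.
-/

/-! ### Quasi-concave functions and intertwining operators -/

/-- Quasi-concave functions on `(0, ∞)` in the sense of interpolation theory: `f` is positive and
increasing and `t ↦ f t / t` is decreasing, the last condition being written without a division.
Nothing is said about `f` outside of `(0, ∞)`. The representing function of an operator mean is of
this kind, and the class is stable under `f ↦ t / f t`. -/
structure IsQuasiconcave (f : ℝ → ℝ) : Prop where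
  pos : ∀ t, 0 < t → 0 < f t
  mono : ∀ s t, 0 < s → s ≤ t → f s ≤ f t
  mul_le_mul : ∀ s t, 0 < s → s ≤ t → f t * s ≤ f s * t

lemma IsQuasiconcave.sqrt : IsQuasiconcave Real.sqrt where
  pos t ht := Real.sqrt_pos.2 ht
  mono s t _ h := Real.sqrt_le_sqrt h
  mul_le_mul s t hs h := by
    have h1 := Real.sqrt_le_sqrt h
    have h2 := Real.mul_self_sqrt hs.le
    have h3 := Real.mul_self_sqrt (hs.le.trans h)
    calc √t * s = (√t * √s) * √s := by rw [mul_assoc, h2]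
      _ ≤ (√t * √s) * √t := by gcongr
      _ = √s * t := by rw [mul_comm √t, mul_assoc, h3]

lemma IsQuasiconcave.id_div {f : ℝ → ℝ} (hf : IsQuasiconcave f) :
    IsQuasiconcave fun t => t / f t where
  pos t ht := div_pos ht (hf.pos t ht)
  mono s t hs h := by
    rw [div_le_div_iff₀ (hf.pos s hs) (hf.pos t (hs.trans_le h))]
    linarith [hf.mul_le_mul s t hs h]
  mul_le_mul s t hs h := by
    rw [div_mul_eq_mul_div, div_mul_eq_mul_div, mul_comm s t]
    exact div_le_div_of_nonneg_left (by nlinarith) (hf.pos s hs) (hf.mono s t hs h)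

lemma IsQuasiconcave.continuousOn {f : ℝ → ℝ} (hf : IsQuasiconcave f) :
    ContinuousOn f (Ioi 0) := by
  intro t ht
  have ht : 0 < t := ht
  refine ContinuousAt.continuousWithinAt ?_
  -- `f` lies between `f t * min 1 (s / t)` and `f t * max 1 (s / t)`
  have h1 : Tendsto (fun s => f t * min 1 (s / t)) (𝓝 t) (𝓝 (f t)) := by
    have : ContinuousAt (fun s => f t * min 1 (s / t)) t := by fun_prop
    simpa [ContinuousAt, ht.ne'] using this
  have h2 : Tendsto (fun s => f t * max 1 (s / t)) (𝓝 t) (𝓝 (f t)) := by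
    have : ContinuousAt (fun s => f t * max 1 (s / t)) t := by fun_prop
    simpa [ContinuousAt, ht.ne'] using this
  have hft := hf.pos t ht
  refine tendsto_of_tendsto_of_tendsto_of_le_of_le' h1 h2 ?_ ?_ <;>
    filter_upwards [lt_mem_nhds ht] with s hs
  · rcases le_total s t with h | h
    · calc f t * min 1 (s / t) ≤ f t * (s / t) := by gcongr; exact min_le_right _ _
        _ = f t * s / t := by ring
        _ ≤ f s := by rw [div_le_iff₀ ht]; exact hf.mul_le_mul s t hs h
    · calc f t * min 1 (s / t) ≤ f t * 1 := by gcongr; exact min_le_left _ _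
        _ ≤ f s := by rw [mul_one]; exact hf.mono t s ht h
  · rcases le_total s t with h | h
    · calc f s ≤ f t * 1 := by rw [mul_one]; exact hf.mono s t hs h
        _ ≤ f t * max 1 (s / t) := by gcongr; exact le_max_left _ _
    · calc f s ≤ f t * s / t := by rw [le_div_iff₀ ht]; exact hf.mul_le_mul t s ht h
        _ = f t * (s / t) := by ring
        _ ≤ f t * max 1 (s / t) := by gcongr; exact le_max_right _ _

/-- With this estimate, limits `c ↓ 1` are taken outside of the functional calculus. -/
lemma IsQuasiconcave.map_mul_le {f : ℝ → ℝ} (hf : IsQuasiconcave f) {c t : ℝ} (hc : 1 ≤ c)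
    (ht : 0 < t) : f (c * t) ≤ c * f t := by
  have h := hf.mul_le_mul t (c * t) ht (by nlinarith)
  nlinarith

section Operators

variable {H : Type*} [NormedAddCommGroup H] [InnerProductSpace ℂ H] [CompleteSpace H]
  {K : Type*} [NormedAddCommGroup K] [InnerProductSpace ℂ K] [CompleteSpace K]

lemma IsStrictlyPositive.spectrum_subset_Ioi {S : H →L[ℂ] H} (hS : IsStrictlyPositive S) :
    spectrum ℝ S ⊆ Ioi 0 := fun _ hx => hS.spectrum_pos hx

lemma isStrictlyPositive_of_algebraMap_le {S : H →L[ℂ] H} {r : ℝ} (hr : 0 < r)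
    (h : algebraMap ℝ (H →L[ℂ] H) r ≤ S) : IsStrictlyPositive S :=
  (isStrictlyPositive_algebraMap hr).of_le h

lemma IsStrictlyPositive.exists_algebraMap_le {S : H →L[ℂ] H} (hS : IsStrictlyPositive S) :
    ∃ r : ℝ, 0 < r ∧ algebraMap ℝ (H →L[ℂ] H) r ≤ S := by
  rcases subsingleton_or_nontrivial H with h | h
  · exact ⟨1, one_pos, (Subsingleton.elim _ _).le⟩
  obtain ⟨r, hr, h⟩ := (CFC.exists_pos_algebraMap_le_iff hS.isSelfAdjoint).2
    fun x hx => hS.spectrum_pos hx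
  exact ⟨r, hr, h⟩

lemma ContinuousOn.cfc_spectrum {f : ℝ → ℝ} (hf : ContinuousOn f (Ioi 0)) {S : H →L[ℂ] H}
    (hS : IsStrictlyPositive S) : ContinuousOn f (spectrum ℝ S) :=
  hf.mono hS.spectrum_subset_Ioi

lemma IsQuasiconcave.isStrictlyPositive_cfc {f : ℝ → ℝ} (hf : IsQuasiconcave f)
    {S : H →L[ℂ] H} (hS : IsStrictlyPositive S) : IsStrictlyPositive (cfc f S) := by
  have hc := hf.continuousOn.cfc_spectrum hS
  rw [CStarAlgebra.isStrictlyPositive_iff_isSelfAdjoint_and_spectrum_pos]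
  refine ⟨cfc_predicate f S, ?_⟩
  rw [cfc_map_spectrum f S hS.isSelfAdjoint hc]
  rintro _ ⟨x, hx, rfl⟩
  exact hf.pos x (hS.spectrum_pos hx)

lemma IsQuasiconcave.cfc_smul_le {f : ℝ → ℝ} (hf : IsQuasiconcave f) {c : ℝ} (hc : 1 ≤ c)
    {S : H →L[ℂ] H} (hS : IsStrictlyPositive S) : cfc f (c • S) ≤ c • cfc f S := by
  have h0 : 0 < c := by linarith
  have h1 : ContinuousOn f ((fun x => c • x) '' spectrum ℝ S) := by
    refine hf.continuousOn.mono ?_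
    rintro _ ⟨x, hx, rfl⟩
    exact mul_pos h0 (hS.spectrum_pos hx)
  have h2 := hf.continuousOn.cfc_spectrum hS
  rw [← cfc_comp_smul c f S h1 hS.isSelfAdjoint, ← cfc_const_mul c f S h2]
  refine cfc_mono (fun x hx => hf.map_mul_le hc (hS.spectrum_pos hx)) ?_ ?_
  · exact h1.comp (by fun_prop) (mapsTo_image _ _)
  · exact h2.const_smul c

open ContinuousLinearMap in
lemma aeval_comp_of_comp_eq {E F : Type*} [NormedAddCommGroup E] [InnerProductSpace ℂ E]
    [NormedAddCommGroup F] [InnerProductSpace ℂ F] {W : F →L[ℂ] F} {S : E →L[ℂ] E} {T : E →L[ℂ] F}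
    (h : W ∘L T = T ∘L S) (p : Polynomial ℝ) :
    Polynomial.aeval W p ∘L T = T ∘L Polynomial.aeval S p := by
  have hpow : ∀ n : ℕ, (W ^ n) ∘L T = T ∘L (S ^ n) := by
    intro n
    induction n with
    | zero => rfl
    | succ n ih =>
      rw [pow_succ, pow_succ, mul_def, mul_def, comp_assoc, h, ← comp_assoc, ih, comp_assoc]
  induction p using Polynomial.induction_on' with
  | add p q hp hq => simp only [map_add, add_comp, comp_add, hp, hq]
  | monomial n a =>
    simp only [Polynomial.aeval_monomial, ← Algebra.smul_def, smul_comp, comp_smul, hpow]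

open ContinuousLinearMap in
/-- The continuous functional calculus respects intertwining operators between two spaces; the
proof is by polynomial approximation on an interval that contains both spectra. -/
lemma cfc_comp_of_comp_eq {W : K →L[ℂ] K} {S : H →L[ℂ] H} {T : H →L[ℂ] K}
    (hW : IsStrictlyPositive W) (hS : IsStrictlyPositive S)
    (h : W ∘L T = T ∘L S) {f : ℝ → ℝ} (hf : ContinuousOn f (Ioi 0)) :
    cfc f W ∘L T = T ∘L cfc f S := by
  obtain ⟨a, b, ha, hWab, hSab⟩ : ∃ a b : ℝ, 0 < a ∧ spectrum ℝ W ⊆ Icc a b ∧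
      spectrum ℝ S ⊆ Icc a b := by
    obtain ⟨r, hr, hr'⟩ := hW.exists_algebraMap_le
    obtain ⟨s, hs, hs'⟩ := hS.exists_algebraMap_le
    rw [algebraMap_le_iff_le_spectrum hW.isSelfAdjoint] at hr'
    rw [algebraMap_le_iff_le_spectrum hS.isSelfAdjoint] at hs'
    have hW' := (le_algebraMap_iff_spectrum_le hW.isSelfAdjoint).1
      (hW.isSelfAdjoint.le_algebraMap_norm_self)
    have hS' := (le_algebraMap_iff_spectrum_le hS.isSelfAdjoint).1
      (hS.isSelfAdjoint.le_algebraMap_norm_self)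
    exact ⟨min r s, max ‖W‖ ‖S‖, lt_min hr hs,
      fun x hx => ⟨(min_le_left _ _).trans (hr' x hx), (hW' x hx).trans (le_max_left _ _)⟩,
      fun x hx => ⟨(min_le_right _ _).trans (hs' x hx), (hS' x hx).trans (le_max_right _ _)⟩⟩
  have key : ∀ ε : ℝ, 0 < ε → ‖cfc f W ∘L T - T ∘L cfc f S‖ ≤ ε * (2 * ‖T‖) := by
    intro ε hε
    obtain ⟨p, hp⟩ := exists_polynomial_near_of_continuousOn a b f
      (hf.mono fun x hx => ha.trans_le hx.1) ε hε
    have h1 : ‖cfc f W - Polynomial.aeval W p‖ ≤ ε := by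
      rw [← cfc_polynomial p W hW.isSelfAdjoint,
        ← cfc_sub f _ W (hf.cfc_spectrum hW) (by fun_prop)]
      refine norm_cfc_le hε.le fun x hx => ?_
      rw [norm_sub_rev]
      exact (hp x (hWab hx)).le
    have h2 : ‖cfc f S - Polynomial.aeval S p‖ ≤ ε := by
      rw [← cfc_polynomial p S hS.isSelfAdjoint,
        ← cfc_sub f _ S (hf.cfc_spectrum hS) (by fun_prop)]
      refine norm_cfc_le hε.le fun x hx => ?_
      rw [norm_sub_rev]
      exact (hp x (hSab hx)).le
    have h3 : cfc f W ∘L T - T ∘L cfc f S =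
        (cfc f W - Polynomial.aeval W p) ∘L T - T ∘L (cfc f S - Polynomial.aeval S p) := by
      rw [sub_comp, comp_sub, aeval_comp_of_comp_eq h p]
      abel
    rw [h3]
    calc _ ≤ ‖(cfc f W - Polynomial.aeval W p) ∘L T‖ + ‖T ∘L (cfc f S - Polynomial.aeval S p)‖ :=
          norm_sub_le _ _
      _ ≤ ‖cfc f W - Polynomial.aeval W p‖ * ‖T‖ + ‖T‖ * ‖cfc f S - Polynomial.aeval S p‖ :=
          add_le_add (opNorm_comp_le _ _) (opNorm_comp_le _ _)
      _ ≤ ε * ‖T‖ + ‖T‖ * ε := by gcongr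
      _ = ε * (2 * ‖T‖) := by ring
  have h0 : ‖cfc f W ∘L T - T ∘L cfc f S‖ ≤ 0 := by
    have ht : Tendsto (fun ε : ℝ => ε * (2 * ‖T‖)) (𝓝[>] 0) (𝓝 0) := by
      have : ContinuousAt (fun ε : ℝ => ε * (2 * ‖T‖)) 0 := by fun_prop
      simpa [ContinuousAt] using this.tendsto.mono_left nhdsWithin_le_nhds
    exact ge_of_tendsto ht (eventually_mem_nhdsWithin.mono fun ε hε => key ε hε)
  exact sub_eq_zero.1 (norm_le_zero_iff.1 h0)

/-- `f` is monotone on the strictly positive bounded operators on `K`. Unlike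
`IsMonotoneOnOperators`, this does not involve the value of `f` at `0`. -/
def IsMonotoneOnStrictlyPositive (K : Type*) [NormedAddCommGroup K] [InnerProductSpace ℂ K]
    [CompleteSpace K] (f : ℝ → ℝ) : Prop :=
  ∀ S T : K →L[ℂ] K, IsStrictlyPositive S → S ≤ T → cfc f S ≤ cfc f T

end Operators

/-! ### Jensen's operator inequality -/

section Compression

open ContinuousLinearMap

variable {H : Type*} [NormedAddCommGroup H] [InnerProductSpace ℂ H] [CompleteSpace H]
  {K : Type*} [NormedAddCommGroup K] [InnerProductSpace ℂ K] [CompleteSpace K]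

lemma adjoint_conj_mono (V : H →L[ℂ] K) {S T : K →L[ℂ] K} (h : S ≤ T) :
    adjoint V ∘L S ∘L V ≤ adjoint V ∘L T ∘L V := by
  rw [ContinuousLinearMap.le_def] at h ⊢
  convert h.adjoint_conj V using 1
  rw [sub_comp, comp_sub]

lemma isStrictlyPositive_adjoint_conj {V : H →L[ℂ] K} (hV : adjoint V ∘L V = 1)
    {S : K →L[ℂ] K} (hS : IsStrictlyPositive S) :
    IsStrictlyPositive (adjoint V ∘L S ∘L V) := by
  obtain ⟨r, hr, h⟩ := hS.exists_algebraMap_le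
  refine isStrictlyPositive_of_algebraMap_le hr ?_
  refine le_trans (le_of_eq ?_) (adjoint_conj_mono V h)
  rw [Algebra.algebraMap_eq_smul_one, Algebra.algebraMap_eq_smul_one, smul_comp, comp_smul,
    show (1 : K →L[ℂ] K) ∘L V = V from id_comp V, hV]

/-- The Loewner order is closed, applied along `c ↓ 1`. -/
lemma le_of_forall_le_smul {S T : H →L[ℂ] H} (h : ∀ c : ℝ, 1 < c → S ≤ c • T) : S ≤ T := by
  have ht : Tendsto (fun c : ℝ => c • T - S) (𝓝[>] 1) (𝓝 (T - S)) := by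
    have : ContinuousAt (fun c : ℝ => c • T - S) 1 := by fun_prop
    simpa [ContinuousAt] using this.tendsto.mono_left nhdsWithin_le_nhds
  rw [← sub_nonneg]
  exact CStarAlgebra.isClosed_nonneg.mem_of_tendsto ht
    (eventually_mem_nhdsWithin.mono fun c hc => sub_nonneg.2 (h c hc))

/-- Up to weights, an operator `Z ≥ 0` is dominated by its pinching to a decomposition
`1 = P + (1 - P)`: the difference of the two sides is `R Z R` with `R = δ P - δ⁻¹ (1 - P)`. -/
lemma le_pinching {P Z : K →L[ℂ] K} (hP : IsSelfAdjoint P) (hZ : 0 ≤ Z)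
    {δ : ℝ} (hδ : δ ≠ 0) :
    Z ≤ (1 + δ ^ 2) • (P * Z * P) + (1 + (δ⁻¹) ^ 2) • ((1 - P) * Z * (1 - P)) := by
  obtain ⟨Q, hQ⟩ : ∃ Q, Q = 1 - P := ⟨_, rfl⟩
  have hQs : star Q = Q := by rw [hQ, star_sub, star_one, hP.star_eq]
  have h1 : P + Q = 1 := by rw [hQ]; abel
  have key := star_left_conjugate_nonneg hZ (δ • P - δ⁻¹ • Q)
  rw [star_sub, star_smul, star_smul, hP.star_eq, hQs] at key
  rw [← hQ, ← sub_nonneg]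
  refine key.trans_eq ?_
  have h2 : Z = P * Z * P + P * Z * Q + Q * Z * P + Q * Z * Q := by
    calc Z = (P + Q) * Z * (P + Q) := by rw [h1, one_mul, mul_one]
      _ = _ := by noncomm_ring
  simp only [sub_mul, mul_sub, smul_mul_assoc, mul_smul_comm, star_trivial,
    smul_sub, smul_smul, mul_inv_cancel₀ hδ, inv_mul_cancel₀ hδ, one_smul]
  generalize P * Z * P = a at *
  generalize P * Z * Q = b at *
  generalize Q * Z * P = c at *
  generalize Q * Z * Q = d at *
  rw [h2]
  module

/-- Jensen's inequality for a compression by an isometry `V : H → K`. The pinching `W ≥ Z` with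
weight `c > 1` on the range of `V` is intertwined by `V` with `c V* Z V`, hence
`V* f(Z) V ≤ V* f(W) V = f(c V* Z V) ≤ c f(V* Z V)`, and `c` tends to `1`. -/
theorem adjoint_conj_cfc_le {f : ℝ → ℝ} (hf : IsQuasiconcave f)
    (hK : IsMonotoneOnStrictlyPositive K f) {V : H →L[ℂ] K} (hV : adjoint V ∘L V = 1)
    {Z : K →L[ℂ] K} (hZ : IsStrictlyPositive Z) :
    adjoint V ∘L cfc f Z ∘L V ≤ cfc f (adjoint V ∘L Z ∘L V) := by
  have hX := isStrictlyPositive_adjoint_conj hV hZ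
  refine le_of_forall_le_smul fun c hc => ?_
  have hc0 : 0 < c := by linarith
  obtain ⟨P, hP⟩ : ∃ P, P = V ∘L adjoint V := ⟨_, rfl⟩
  have hPs : IsSelfAdjoint P := by
    rw [hP, isSelfAdjoint_iff', adjoint_comp, adjoint_adjoint]
  have hPV : P ∘L V = V := by rw [hP, comp_assoc, hV]; rfl
  -- `δ ^ 2 = c - 1` gives the weight `1 + δ ^ 2 = c` on the range of `V`
  have hle := le_pinching hPs hZ.nonneg (δ := √(c - 1))
    (Real.sqrt_pos.2 (by linarith)).ne'
  rw [Real.sq_sqrt (by linarith), add_sub_cancel] at hle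
  set W := c • (P * Z * P) + (1 + (√(c - 1))⁻¹ ^ 2) • ((1 - P) * Z * (1 - P)) with hW
  have hWV : W ∘L V = V ∘L (c • (adjoint V ∘L Z ∘L V)) := by
    have h1 : (P * Z * P) ∘L V = V ∘L (adjoint V ∘L Z ∘L V) := by
      rw [mul_def, mul_def, comp_assoc, hPV, hP]
      rfl
    have h2 : ((1 - P) * Z * (1 - P)) ∘L V = 0 := by
      rw [mul_def, comp_assoc, sub_comp, hPV, one_def, id_comp, sub_self, comp_zero]
    rw [hW, add_comp, smul_comp, smul_comp, h1, h2, smul_zero, add_zero, comp_smul]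
  have hcX : IsStrictlyPositive (c • (adjoint V ∘L Z ∘L V)) := hX.smul hc0
  have h := adjoint_conj_mono V (hK Z W hZ hle)
  rw [cfc_comp_of_comp_eq (hZ.of_le hle) hcX hWV hf.continuousOn,
    ← comp_assoc (adjoint V) V, hV, one_def, id_comp] at h
  exact h.trans (hf.cfc_smul_le hc.le hX)

/-- The Hansen–Pedersen form of Jensen's inequality, for `C* C + D* D = 1`: the compression
inequality for the column isometry `V₁ C + V₂ D : H → K` and an operator on `K` that acts as `X`
and `Y` on the ranges of `V₁` and `V₂`. -/
theorem star_conj_cfc_add_le {f : ℝ → ℝ} (hf : IsQuasiconcave f)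
    (hK : IsMonotoneOnStrictlyPositive K f) {V₁ V₂ : H →L[ℂ] K} (h₁ : adjoint V₁ ∘L V₁ = 1)
    (h₂ : adjoint V₂ ∘L V₂ = 1) (h₁₂ : adjoint V₁ ∘L V₂ = 0)
    {X Y C D : H →L[ℂ] H} (hX : IsStrictlyPositive X) (hY : IsStrictlyPositive Y)
    (hCD : star C * C + star D * D = 1) :
    star C * cfc f X * C + star D * cfc f Y * D ≤ cfc f (star C * X * C + star D * Y * D) := by
  have h₂₁ : adjoint V₂ ∘L V₁ = 0 := by
    have := congrArg adjoint h₁₂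
    rwa [adjoint_comp, adjoint_adjoint, map_zero] at this
  obtain ⟨r, hr, hrX⟩ := hX.exists_algebraMap_le
  obtain ⟨s, hs, hsY⟩ := hY.exists_algebraMap_le
  have key : ∀ ε : ℝ, 0 < ε → algebraMap ℝ (H →L[ℂ] H) ε ≤ X → algebraMap ℝ (H →L[ℂ] H) ε ≤ Y →
      ∃ Z : K →L[ℂ] K, IsStrictlyPositive Z ∧ Z ∘L V₁ = V₁ ∘L X ∧ Z ∘L V₂ = V₂ ∘L Y := by
    intro ε hε hεX hεY
    -- adding the scalar `ε` keeps `Z` strictly positive off the ranges of `V₁` and `V₂`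
    refine ⟨algebraMap ℝ (K →L[ℂ] K) ε +
      (V₁ ∘L (X - algebraMap ℝ _ ε) ∘L adjoint V₁ + V₂ ∘L (Y - algebraMap ℝ _ ε) ∘L adjoint V₂),
      isStrictlyPositive_of_algebraMap_le hε (le_add_of_nonneg_right (add_nonneg ?_ ?_)), ?_, ?_⟩
    · rw [nonneg_iff_isPositive]
      exact ((nonneg_iff_isPositive _).1 (sub_nonneg.2 hεX)).conj_adjoint V₁
    · rw [nonneg_iff_isPositive]
      exact ((nonneg_iff_isPositive _).1 (sub_nonneg.2 hεY)).conj_adjoint V₂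
    · simp only [add_comp, comp_assoc, h₁, h₂₁, comp_zero, Algebra.algebraMap_eq_smul_one,
        smul_comp, one_def, id_comp, comp_id, comp_sub, comp_smul]
      abel
    · simp only [add_comp, comp_assoc, h₂, h₁₂, comp_zero, Algebra.algebraMap_eq_smul_one,
        smul_comp, one_def, id_comp, comp_id, comp_sub, comp_smul]
      abel
  obtain ⟨Z, hZ, hZ1, hZ2⟩ := key (min r s) (lt_min hr hs)
    ((algebraMap_mono _ (min_le_left r s)).trans hrX)
    ((algebraMap_mono _ (min_le_right r s)).trans hsY)
  -- the column isometry `V = V₁ C + V₂ D` compresses an operator that acts as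
  -- `X'` and `Y'` on the two ranges to `C* X' C + D* Y' D`
  have conj : ∀ (Z' : K →L[ℂ] K) (X' Y' : H →L[ℂ] H), Z' ∘L V₁ = V₁ ∘L X' →
      Z' ∘L V₂ = V₂ ∘L Y' →
      adjoint (V₁ ∘L C + V₂ ∘L D) ∘L Z' ∘L (V₁ ∘L C + V₂ ∘L D) =
        star C * X' * C + star D * Y' * D := by
    intro Z' X' Y' hX' hY'
    have e1 : Z' ∘L (V₁ ∘L C + V₂ ∘L D) = V₁ ∘L (X' ∘L C) + V₂ ∘L (Y' ∘L D) := by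
      rw [comp_add, ← comp_assoc, hX', ← comp_assoc, hY', comp_assoc, comp_assoc]
    have f1 : ∀ T : H →L[ℂ] H, adjoint V₁ ∘L (V₁ ∘L T) = T := fun T => by
      rw [← comp_assoc, h₁, one_def, id_comp]
    have f2 : ∀ T : H →L[ℂ] H, adjoint V₂ ∘L (V₂ ∘L T) = T := fun T => by
      rw [← comp_assoc, h₂, one_def, id_comp]
    have f3 : ∀ T : H →L[ℂ] H, adjoint V₁ ∘L (V₂ ∘L T) = 0 := fun T => by
      rw [← comp_assoc, h₁₂, zero_comp]
    have f4 : ∀ T : H →L[ℂ] H, adjoint V₂ ∘L (V₁ ∘L T) = 0 := fun T => by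
      rw [← comp_assoc, h₂₁, zero_comp]
    rw [e1, map_add, adjoint_comp, adjoint_comp, add_comp, comp_add, comp_add]
    simp only [comp_assoc, f1, f2, f3, f4, comp_zero, add_zero, zero_add, mul_def, star_eq_adjoint]
  have hV : adjoint (V₁ ∘L C + V₂ ∘L D) ∘L (V₁ ∘L C + V₂ ∘L D) = 1 := by
    have := conj 1 1 1 rfl rfl
    rw [mul_one, mul_one, hCD] at this
    exact this
  have := adjoint_conj_cfc_le hf hK hV hZ
  rwa [conj Z X Y hZ1 hZ2, conj (cfc f Z) (cfc f X) (cfc f Y)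
    (cfc_comp_of_comp_eq hZ hX hZ1 hf.continuousOn)
    (cfc_comp_of_comp_eq hZ hY hZ2 hf.continuousOn)] at this

end Compression

/-! ### Means defined by a function -/

section MeanOfFunction

variable {H : Type*} [NormedAddCommGroup H] [InnerProductSpace ℂ H] [CompleteSpace H]

lemma star_rpow (A : H →L[ℂ] H) (x : ℝ) : star (A ^ x) = A ^ x :=
  (IsSelfAdjoint.of_nonneg CFC.rpow_nonneg).star_eq

lemma rpow_half_mul_neg {A : H →L[ℂ] H} (hA : IsStrictlyPositive A) :
    A ^ (1 / 2 : ℝ) * A ^ (-(1 / 2) : ℝ) = 1 := CFC.rpow_mul_rpow_neg _ hA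

lemma rpow_neg_half_mul {A : H →L[ℂ] H} (hA : IsStrictlyPositive A) :
    A ^ (-(1 / 2) : ℝ) * A ^ (1 / 2 : ℝ) = 1 := CFC.rpow_neg_mul_rpow _ hA

lemma rpow_half_mul_self {A : H →L[ℂ] H} (hA : IsStrictlyPositive A) :
    A ^ (1 / 2 : ℝ) * A ^ (1 / 2 : ℝ) = A := by
  rw [← CFC.rpow_add hA.isUnit]
  norm_num
  exact CFC.rpow_one A hA.nonneg

lemma isStrictlyPositive_rpow_conj {A B : H →L[ℂ] H} (hA : IsStrictlyPositive A)
    (hB : IsStrictlyPositive B) (x : ℝ) : IsStrictlyPositive (A ^ x * B * A ^ x) := by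
  have h := (IsStrictlyPositive.rpow A x hA).isUnit.isStrictlyPositive_star_left_conjugate_iff.2 hB
  rwa [star_rpow] at h

lemma isStrictlyPositive_meanOfFunction {f : ℝ → ℝ} (hf : IsQuasiconcave f) {A B : H →L[ℂ] H}
    (hA : IsStrictlyPositive A) (hB : IsStrictlyPositive B) :
    IsStrictlyPositive (meanOfFunction f A B) :=
  isStrictlyPositive_rpow_conj hA
    (hf.isStrictlyPositive_cfc (isStrictlyPositive_rpow_conj hA hB _)) _

end MeanOfFunction

/-! ### Superadditivity, and operator monotonicity of the dual function -/

section Superadditivity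

open ContinuousLinearMap

variable {H : Type*} [NormedAddCommGroup H] [InnerProductSpace ℂ H] [CompleteSpace H]
  {K : Type*} [NormedAddCommGroup K] [InnerProductSpace ℂ K] [CompleteSpace K]

/-- There are two isometries `H → K` with orthogonal ranges, i.e. `H ⊕ H` embeds isometrically
into `K`. An infinite-dimensional `H` has this property with `K = H`. -/
def HasOrthogonalIsometries (H K : Type*) [NormedAddCommGroup H] [InnerProductSpace ℂ H]
    [CompleteSpace H] [NormedAddCommGroup K] [InnerProductSpace ℂ K] [CompleteSpace K] : Prop :=
  ∃ V₁ V₂ : H →L[ℂ] K, adjoint V₁ ∘L V₁ = 1 ∧ adjoint V₂ ∘L V₂ = 1 ∧ adjoint V₁ ∘L V₂ = 0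

/-- Superadditivity: Jensen's inequality with `C = A₁^{1/2} A^{-1/2}` and `D = A₂^{1/2} A^{-1/2}`,
where `A = A₁ + A₂`. -/
theorem meanOfFunction_add_le {f : ℝ → ℝ} (hf : IsQuasiconcave f)
    (hHK : HasOrthogonalIsometries H K) (hK : IsMonotoneOnStrictlyPositive K f)
    {A₁ A₂ B₁ B₂ : H →L[ℂ] H} (hA₁ : IsStrictlyPositive A₁) (hA₂ : IsStrictlyPositive A₂)
    (hB₁ : IsStrictlyPositive B₁) (hB₂ : IsStrictlyPositive B₂) :
    meanOfFunction f A₁ B₁ + meanOfFunction f A₂ B₂ ≤ meanOfFunction f (A₁ + A₂) (B₁ + B₂) := by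
  obtain ⟨V₁, V₂, h₁, h₂, h₁₂⟩ := hHK
  have hA := hA₁.add_nonneg hA₂.nonneg
  obtain ⟨A, hAdef⟩ : ∃ A, A = A₁ + A₂ := ⟨_, rfl⟩
  rw [← hAdef] at hA ⊢
  have hsC : ∀ M : H →L[ℂ] H, star (M ^ (1 / 2 : ℝ) * A ^ (-(1 / 2) : ℝ)) =
      A ^ (-(1 / 2) : ℝ) * M ^ (1 / 2 : ℝ) := fun M => by
    rw [star_mul, star_rpow, star_rpow]
  have hCD : star (A₁ ^ (1 / 2 : ℝ) * A ^ (-(1 / 2) : ℝ)) * (A₁ ^ (1 / 2 : ℝ) * A ^ (-(1 / 2) : ℝ)) +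
      star (A₂ ^ (1 / 2 : ℝ) * A ^ (-(1 / 2) : ℝ)) * (A₂ ^ (1 / 2 : ℝ) * A ^ (-(1 / 2) : ℝ)) = 1 := by
    rw [hsC, hsC]
    calc _ = A ^ (-(1 / 2) : ℝ) * (A₁ ^ (1 / 2 : ℝ) * A₁ ^ (1 / 2 : ℝ) +
          A₂ ^ (1 / 2 : ℝ) * A₂ ^ (1 / 2 : ℝ)) * A ^ (-(1 / 2) : ℝ) := by noncomm_ring
      _ = 1 := by
        rw [rpow_half_mul_self hA₁, rpow_half_mul_self hA₂, ← hAdef]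
        exact CFC.conjugate_rpow_neg_one_half A hA
  have hconj : ∀ M B : H →L[ℂ] H, IsStrictlyPositive M →
      star (M ^ (1 / 2 : ℝ) * A ^ (-(1 / 2) : ℝ)) *
        (M ^ (-(1 / 2) : ℝ) * B * M ^ (-(1 / 2) : ℝ)) * (M ^ (1 / 2 : ℝ) * A ^ (-(1 / 2) : ℝ)) =
      A ^ (-(1 / 2) : ℝ) * B * A ^ (-(1 / 2) : ℝ) := by
    intro M B hM
    rw [hsC]
    calc _ = A ^ (-(1 / 2) : ℝ) * (M ^ (1 / 2 : ℝ) * M ^ (-(1 / 2) : ℝ)) * B *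
          (M ^ (-(1 / 2) : ℝ) * M ^ (1 / 2 : ℝ)) * A ^ (-(1 / 2) : ℝ) := by
          simp only [mul_assoc]
      _ = _ := by rw [rpow_half_mul_neg hM, rpow_neg_half_mul hM, mul_one, mul_one]
  have key := star_conj_cfc_add_le hf hK h₁ h₂ h₁₂ (isStrictlyPositive_rpow_conj hA₁ hB₁ (-(1 / 2)))
    (isStrictlyPositive_rpow_conj hA₂ hB₂ (-(1 / 2))) hCD
  rw [hconj A₁ B₁ hA₁, hconj A₂ B₂ hA₂, ← add_mul, ← mul_add] at key
  have key2 := star_left_conjugate_le_conjugate key (A ^ (1 / 2 : ℝ))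
  rw [star_rpow] at key2
  refine le_trans (le_of_eq ?_) key2
  have hback : ∀ M F : H →L[ℂ] H,
      A ^ (1 / 2 : ℝ) * (star (M ^ (1 / 2 : ℝ) * A ^ (-(1 / 2) : ℝ)) * F *
        (M ^ (1 / 2 : ℝ) * A ^ (-(1 / 2) : ℝ))) * A ^ (1 / 2 : ℝ) =
      M ^ (1 / 2 : ℝ) * F * M ^ (1 / 2 : ℝ) := by
    intro M F
    rw [hsC]
    calc _ = (A ^ (1 / 2 : ℝ) * A ^ (-(1 / 2) : ℝ)) * M ^ (1 / 2 : ℝ) * F * M ^ (1 / 2 : ℝ) *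
          (A ^ (-(1 / 2) : ℝ) * A ^ (1 / 2 : ℝ)) := by simp only [mul_assoc]
      _ = _ := by rw [rpow_half_mul_neg hA, rpow_neg_half_mul hA, mul_one, one_mul]
  rw [mul_add, add_mul, hback, hback]
  rfl

lemma isStrictlyPositive_sum {ι : Type*} {s : Finset ι} (hs : s.Nonempty) {A : ι → H →L[ℂ] H}
    (hA : ∀ j, IsStrictlyPositive (A j)) : IsStrictlyPositive (∑ j ∈ s, A j) := by
  induction hs using Finset.Nonempty.cons_induction with
  | singleton a => simpa using hA a
  | cons a s ha hs ih =>
    rw [Finset.sum_cons]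
    exact (hA a).add_nonneg ih.nonneg

theorem sum_meanOfFunction_le {f : ℝ → ℝ} (hf : IsQuasiconcave f)
    (hHK : HasOrthogonalIsometries H K) (hK : IsMonotoneOnStrictlyPositive K f)
    {ι : Type*} {s : Finset ι} (hs : s.Nonempty) {A B : ι → H →L[ℂ] H}
    (hA : ∀ j, IsStrictlyPositive (A j)) (hB : ∀ j, IsStrictlyPositive (B j)) :
    ∑ j ∈ s, meanOfFunction f (A j) (B j) ≤ meanOfFunction f (∑ j ∈ s, A j) (∑ j ∈ s, B j) := by
  induction hs using Finset.Nonempty.cons_induction with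
  | singleton a => simp
  | cons a s ha hs ih =>
    simp only [Finset.sum_cons]
    exact (add_le_add_right ih _).trans (meanOfFunction_add_le hf hHK hK (hA a)
      (isStrictlyPositive_sum hs hA) (hB a) (isStrictlyPositive_sum hs hB))

lemma rpow_eq_cfc {S : H →L[ℂ] H} (hS : IsStrictlyPositive S) (y : ℝ) :
    S ^ y = cfc (fun x : ℝ => x ^ y) S := CFC.rpow_eq_cfc_real hS.nonneg

lemma continuousOn_rpow_spectrum {S : H →L[ℂ] H} (hS : IsStrictlyPositive S) (y : ℝ) :
    ContinuousOn (fun x : ℝ => x ^ y) (spectrum ℝ S) := fun x hx =>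
  (Real.continuousAt_rpow_const x y (.inl (hS.spectrum_pos hx).ne')).continuousWithinAt

lemma rpow_conj_cfc {f : ℝ → ℝ} (hf : ContinuousOn f (Ioi 0)) {S : H →L[ℂ] H}
    (hS : IsStrictlyPositive S) (y : ℝ) :
    S ^ y * cfc f S * S ^ y = cfc (fun x => f x * x ^ (2 * y)) S := by
  have h1 := continuousOn_rpow_spectrum hS y
  have h2 := hf.cfc_spectrum hS
  rw [rpow_eq_cfc hS, ← cfc_mul _ _ S h1 h2, ← cfc_mul (fun x => x ^ y * f x) _ S (h1.mul h2) h1]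
  refine cfc_congr fun x hx => ?_
  have := Real.rpow_add (hS.spectrum_pos hx) y y
  simp only [two_mul, this]
  ring

/-- `X ↦ X^{-1/2} f(X) X^{-1/2}` is decreasing: Jensen's inequality for the contraction
`C = Y^{-1/2} X^{1/2}`, completed by a small multiple of the identity. -/
theorem rpow_neg_half_conj_cfc_anti {f : ℝ → ℝ} (hf : IsQuasiconcave f)
    (hHK : HasOrthogonalIsometries H K) (hH : IsMonotoneOnStrictlyPositive H f)
    (hK : IsMonotoneOnStrictlyPositive K f) {X Y : H →L[ℂ] H} (hX : IsStrictlyPositive X)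
    (hXY : X ≤ Y) :
    Y ^ (-(1 / 2) : ℝ) * cfc f Y * Y ^ (-(1 / 2) : ℝ) ≤
      X ^ (-(1 / 2) : ℝ) * cfc f X * X ^ (-(1 / 2) : ℝ) := by
  obtain ⟨V₁, V₂, h₁, h₂, h₁₂⟩ := hHK
  have hY := hX.of_le hXY
  -- the contraction `C = Y^{-1/2} X^{1/2}` satisfies `C* Y C = X`
  obtain ⟨C, hC⟩ : ∃ C, C = Y ^ (-(1 / 2) : ℝ) * X ^ (1 / 2 : ℝ) := ⟨_, rfl⟩
  have hsC : star C = X ^ (1 / 2 : ℝ) * Y ^ (-(1 / 2) : ℝ) := by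
    rw [hC, star_mul, star_rpow, star_rpow]
  have hYY : Y ^ (-(1 / 2) : ℝ) * Y * Y ^ (-(1 / 2) : ℝ) = 1 :=
    CFC.conjugate_rpow_neg_one_half Y hY
  have hCYC : star C * Y * C = X := by
    rw [hsC, hC]
    calc _ = X ^ (1 / 2 : ℝ) * (Y ^ (-(1 / 2) : ℝ) * Y * Y ^ (-(1 / 2) : ℝ)) * X ^ (1 / 2 : ℝ) := by
          simp only [mul_assoc]
      _ = X := by rw [hYY, mul_one, rpow_half_mul_self hX]
  have hCC : star C * C ≤ 1 := by
    have h1 : C * star C ≤ 1 := by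
      have := star_left_conjugate_le_conjugate hXY (Y ^ (-(1 / 2) : ℝ))
      rw [star_rpow, hYY] at this
      refine le_trans (le_of_eq ?_) this
      rw [hsC, hC]
      nth_rewrite 3 [← rpow_half_mul_self hX]
      simp only [mul_assoc]
    rw [← CStarAlgebra.norm_le_one_iff_of_nonneg _ (star_mul_self_nonneg C),
      CStarRing.norm_star_mul_self]
    rwa [← CStarAlgebra.norm_le_one_iff_of_nonneg _ (mul_star_self_nonneg C),
      CStarRing.norm_self_mul_star] at h1
  obtain ⟨D, hD⟩ : ∃ D, D = CFC.sqrt (1 - star C * C) := ⟨_, rfl⟩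
  have hDD : D * D = 1 - star C * C := by rw [hD]; exact CFC.sqrt_mul_sqrt_self _ (sub_nonneg.2 hCC)
  have hsD : star D = D := by rw [hD]; exact (IsSelfAdjoint.of_nonneg (CFC.sqrt_nonneg _)).star_eq
  have hCD : star C * C + star D * D = 1 := by rw [hsD, hDD]; abel
  have key : star C * cfc f Y * C ≤ cfc f X := by
    refine le_of_forall_le_smul fun c hc => ?_
    obtain ⟨r, hr, hrX⟩ := hX.exists_algebraMap_le
    have hε : 0 < (c - 1) * r := mul_pos (by linarith) hr
    have hE : IsStrictlyPositive (algebraMap ℝ (H →L[ℂ] H) ((c - 1) * r)) :=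
      isStrictlyPositive_algebraMap hε
    have hJ := star_conj_cfc_add_le hf hK h₁ h₂ h₁₂ hY hE hCD
    rw [hCYC] at hJ
    have hle : X + star D * algebraMap ℝ (H →L[ℂ] H) ((c - 1) * r) * D ≤ c • X := by
      have e1 : star D * algebraMap ℝ (H →L[ℂ] H) ((c - 1) * r) * D =
          ((c - 1) * r) • (1 - star C * C) := by
        rw [hsD, Algebra.algebraMap_eq_smul_one, mul_smul_comm, mul_one, smul_mul_assoc, hDD]
      have e2 : ((c - 1) * r) • (1 - star C * C) ≤ ((c - 1) * r) • (1 : H →L[ℂ] H) :=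
        smul_le_smul_of_nonneg_left (sub_le_self _ (star_mul_self_nonneg C)) hε.le
      have e3 : ((c - 1) * r) • (1 : H →L[ℂ] H) ≤ (c - 1) • X := by
        rw [mul_smul, ← Algebra.algebraMap_eq_smul_one]
        exact smul_le_smul_of_nonneg_left hrX (by linarith)
      calc _ ≤ X + (c - 1) • X := by rw [e1]; exact add_le_add_right (e2.trans e3) _
        _ = c • X := by module
    calc star C * cfc f Y * C
        ≤ star C * cfc f Y * C + star D * cfc f (algebraMap ℝ (H →L[ℂ] H) ((c - 1) * r)) * D :=
          le_add_of_nonneg_right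
            (star_left_conjugate_nonneg (hf.isStrictlyPositive_cfc hE).nonneg D)
      _ ≤ _ := hJ
      _ ≤ cfc f (c • X) := hH _ _ (hX.add_nonneg (star_left_conjugate_nonneg hE.nonneg D)) hle
      _ ≤ c • cfc f X := hf.cfc_smul_le hc.le hX
  have key2 := star_left_conjugate_le_conjugate key (X ^ (-(1 / 2) : ℝ))
  rw [star_rpow] at key2
  refine le_trans (le_of_eq ?_) key2
  rw [hsC, hC]
  calc _ = (X ^ (-(1 / 2) : ℝ) * X ^ (1 / 2 : ℝ)) * Y ^ (-(1 / 2) : ℝ) * cfc f Y *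
        Y ^ (-(1 / 2) : ℝ) * (X ^ (1 / 2 : ℝ) * X ^ (-(1 / 2) : ℝ)) := by
        rw [rpow_half_mul_neg hX, rpow_neg_half_mul hX, mul_one, one_mul]
    _ = _ := by simp only [mul_assoc]

/-- If `f` is operator monotone, so is `t / f t`, with the loss of one doubling of the space. -/
theorem IsMonotoneOnStrictlyPositive.id_div {f : ℝ → ℝ} (hf : IsQuasiconcave f)
    (hHK : HasOrthogonalIsometries H K) (hH : IsMonotoneOnStrictlyPositive H f)
    (hK : IsMonotoneOnStrictlyPositive K f) :
    IsMonotoneOnStrictlyPositive H fun t => t / f t := by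
  intro X Y hX hXY
  have hinv : ∀ S : H →L[ℂ] H, IsStrictlyPositive S →
      IsStrictlyPositive (S ^ (-(1 / 2) : ℝ) * cfc f S * S ^ (-(1 / 2) : ℝ)) ∧
      cfc (fun t => t / f t) S =
        Ring.inverse (S ^ (-(1 / 2) : ℝ) * cfc f S * S ^ (-(1 / 2) : ℝ)) := by
    intro S hS
    have hp := isStrictlyPositive_rpow_conj hS (hf.isStrictlyPositive_cfc hS) (-(1 / 2))
    refine ⟨hp, ?_⟩
    refine ((Ring.inverse_mul_eq_iff_eq_mul _ 1 _ hp.isUnit).2 ?_).symm.trans (mul_one _)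
    rw [rpow_conj_cfc hf.continuousOn hS]
    have h1 : ContinuousOn (fun x : ℝ => f x * x ^ (2 * (-(1 / 2)) : ℝ)) (spectrum ℝ S) :=
      (hf.continuousOn.cfc_spectrum hS).mul (continuousOn_rpow_spectrum hS _)
    rw [← cfc_mul _ _ S h1 (hf.id_div.continuousOn.cfc_spectrum hS),
      ← cfc_one ℝ S hS.isSelfAdjoint]
    refine cfc_congr fun x hx => ?_
    have hx0 : 0 < x := hS.spectrum_pos hx
    have := (hf.pos x hx0).ne'
    norm_num [Real.rpow_neg_one]
    field_simp
  rw [(hinv X hX).2, (hinv Y (hX.of_le hXY)).2]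
  exact CStarAlgebra.ringInverse_le_ringInverse
    (rpow_neg_half_conj_cfc_anti hf hHK hH hK hX hXY) (hinv Y (hX.of_le hXY)).1

end Superadditivity

/-! ### The geometric mean -/

section GeometricMean

variable {H : Type*} [NormedAddCommGroup H] [InnerProductSpace ℂ H] [CompleteSpace H]

lemma geometricMean_eq_meanOfFunction {A B : H →L[ℂ] H}
    (hA : IsStrictlyPositive A) (hB : IsStrictlyPositive B) :
    geometricMean A B = meanOfFunction Real.sqrt A B := by
  rw [geometricMean, meanOfFunction, rpow_eq_cfc (isStrictlyPositive_rpow_conj hA hB _)]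
  have : Real.sqrt = fun x => x ^ (1 / 2 : ℝ) := funext Real.sqrt_eq_rpow
  rw [this]

lemma isMonotoneOnStrictlyPositive_sqrt : IsMonotoneOnStrictlyPositive H Real.sqrt := by
  intro S T hS hST
  have h := CFC.rpow_le_rpow (p := 1 / 2) ⟨by norm_num, by norm_num⟩ hST
  rw [rpow_eq_cfc hS, rpow_eq_cfc (hS.of_le hST)] at h
  simpa only [← Real.sqrt_eq_rpow] using h

lemma isStrictlyPositive_geometricMean {A B : H →L[ℂ] H}
    (hA : IsStrictlyPositive A) (hB : IsStrictlyPositive B) :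
    IsStrictlyPositive (geometricMean A B) := by
  rw [geometricMean_eq_meanOfFunction hA hB]
  exact isStrictlyPositive_meanOfFunction .sqrt hA hB

/-- An inverse of `A` is given as an operator `A'` with `A * A' = 1` here and below. -/
lemma inv_eq_rpow_neg_half_mul_self {A A' : H →L[ℂ] H} (hA : IsStrictlyPositive A)
    (h : A * A' = 1) : A' = A ^ (-(1 / 2) : ℝ) * A ^ (-(1 / 2) : ℝ) := by
  refine (left_inv_eq_right_inv ?_ h).symm
  nth_rewrite 3 [← rpow_half_mul_self hA]
  calc _ = A ^ (-(1 / 2) : ℝ) * (A ^ (-(1 / 2) : ℝ) * A ^ (1 / 2 : ℝ)) * A ^ (1 / 2 : ℝ) := by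
        simp only [mul_assoc]
    _ = 1 := by rw [rpow_neg_half_mul hA, mul_one, rpow_neg_half_mul hA]

/-- `A ♯ B` is the only positive solution `G` of the Riccati equation `G A⁻¹ G = B`. -/
lemma eq_geometricMean {A A' B G : H →L[ℂ] H} (hA : IsStrictlyPositive A)
    (hB : IsStrictlyPositive B) (hAA' : A * A' = 1) (hG : 0 ≤ G) (h : G * A' * G = B) :
    G = geometricMean A B := by
  have hN : 0 ≤ A ^ (-(1 / 2) : ℝ) * G * A ^ (-(1 / 2) : ℝ) := by
    have := star_left_conjugate_nonneg hG (A ^ (-(1 / 2) : ℝ))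
    rwa [star_rpow] at this
  have hsq : (A ^ (-(1 / 2) : ℝ) * B * A ^ (-(1 / 2) : ℝ)) ^ (1 / 2 : ℝ) =
      A ^ (-(1 / 2) : ℝ) * G * A ^ (-(1 / 2) : ℝ) := by
    rw [← CFC.sqrt_eq_rpow, CFC.sqrt_eq_iff _ _ (isStrictlyPositive_rpow_conj hA hB _).nonneg hN,
      ← h, inv_eq_rpow_neg_half_mul_self hA hAA']
    simp only [mul_assoc]
  rw [geometricMean, hsq]
  calc G = (A ^ (1 / 2 : ℝ) * A ^ (-(1 / 2) : ℝ)) * G * (A ^ (-(1 / 2) : ℝ) * A ^ (1 / 2 : ℝ)) := by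
        rw [rpow_half_mul_neg hA, rpow_neg_half_mul hA, mul_one, one_mul]
    _ = _ := by simp only [mul_assoc]

/-- `A ♯ B` solves the Riccati equation `G A⁻¹ G = B`. -/
lemma geometricMean_mul_mul {A A' B : H →L[ℂ] H} (hA : IsStrictlyPositive A)
    (hB : IsStrictlyPositive B) (hAA' : A * A' = 1) :
    geometricMean A B * A' * geometricMean A B = B := by
  rw [inv_eq_rpow_neg_half_mul_self hA hAA', geometricMean]
  have hX := isStrictlyPositive_rpow_conj hA hB (-(1 / 2))
  generalize hXdef : A ^ (-(1 / 2) : ℝ) * B * A ^ (-(1 / 2) : ℝ) = X at hX ⊢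
  calc _ = A ^ (1 / 2 : ℝ) * X ^ (1 / 2 : ℝ) * (A ^ (1 / 2 : ℝ) * A ^ (-(1 / 2) : ℝ)) *
        (A ^ (-(1 / 2) : ℝ) * A ^ (1 / 2 : ℝ)) * X ^ (1 / 2 : ℝ) * A ^ (1 / 2 : ℝ) := by
        simp only [mul_assoc]
    _ = A ^ (1 / 2 : ℝ) * (X ^ (1 / 2 : ℝ) * X ^ (1 / 2 : ℝ)) * A ^ (1 / 2 : ℝ) := by
        rw [rpow_half_mul_neg hA, rpow_neg_half_mul hA, mul_one, mul_one]
        simp only [mul_assoc]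
    _ = (A ^ (1 / 2 : ℝ) * A ^ (-(1 / 2) : ℝ)) * B * (A ^ (-(1 / 2) : ℝ) * A ^ (1 / 2 : ℝ)) := by
        rw [rpow_half_mul_self hX, ← hXdef]
        simp only [mul_assoc]
    _ = B := by rw [rpow_half_mul_neg hA, rpow_neg_half_mul hA, mul_one, one_mul]

lemma geometricMean_comm {A B : H →L[ℂ] H} (hA : IsStrictlyPositive A)
    (hB : IsStrictlyPositive B) : geometricMean A B = geometricMean B A := by
  have hG := isStrictlyPositive_geometricMean hA hB
  obtain ⟨A', hAA', hA'A⟩ := isUnit_iff_exists.1 hA.isUnit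
  obtain ⟨G', hGG', hG'G⟩ := isUnit_iff_exists.1 hG.isUnit
  have h := geometricMean_mul_mul hA hB hAA'
  generalize geometricMean A B = G at *
  refine eq_geometricMean hB hA (A' := G' * A * G') ?_ hG.nonneg ?_
  · rw [← h]
    calc _ = G * (A' * ((G * G') * A)) * G' := by simp only [mul_assoc]
      _ = 1 := by rw [hGG', one_mul, hA'A, mul_one, hGG']
  · calc _ = (G * G') * A * (G' * G) := by simp only [mul_assoc]
      _ = A := by rw [hGG', hG'G, mul_one, one_mul]

lemma geometricMean_mono_right (A : H →L[ℂ] H) {B C : H →L[ℂ] H} (h : B ≤ C) :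
    geometricMean A B ≤ geometricMean A C := by
  refine conjugate_le_conjugate_of_nonneg ?_ CFC.rpow_nonneg
  refine CFC.rpow_le_rpow ⟨by norm_num, by norm_num⟩ ?_
  exact conjugate_le_conjugate_of_nonneg h CFC.rpow_nonneg

lemma geometricMean_mono {A B C D : H →L[ℂ] H} (hA : IsStrictlyPositive A)
    (hB : IsStrictlyPositive B) (hAC : A ≤ C) (hBD : B ≤ D) :
    geometricMean A B ≤ geometricMean C D := by
  calc geometricMean A B ≤ geometricMean A D := geometricMean_mono_right A hBD
    _ = geometricMean D A := geometricMean_comm hA (hB.of_le hBD)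
    _ ≤ geometricMean D C := geometricMean_mono_right D hAC
    _ = geometricMean C D := geometricMean_comm (hB.of_le hBD) (hA.of_le hAC)

/-- `(A σ B) ♯ (A σ^⊥ B) = A ♯ B`, where `σ` has the representing function `f`. -/
lemma geometricMean_meanOfFunction {f : ℝ → ℝ} (hf : IsQuasiconcave f) {A B : H →L[ℂ] H}
    (hA : IsStrictlyPositive A) (hB : IsStrictlyPositive B) :
    geometricMean (meanOfFunction f A B) (meanOfFunction (fun t => t / f t) A B) =
      geometricMean A B := by
  have hX := isStrictlyPositive_rpow_conj hA hB (-(1 / 2))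
  have hPf := isStrictlyPositive_meanOfFunction hf hA hB
  have hPg := isStrictlyPositive_meanOfFunction hf.id_div hA hB
  have hG := isStrictlyPositive_geometricMean hA hB
  have hcf := hf.continuousOn.cfc_spectrum hX
  have hci : ContinuousOn (fun t => (f t)⁻¹) (spectrum ℝ _) :=
    hcf.inv₀ fun x hx => (hf.pos x (hX.spectrum_pos hx)).ne'
  rw [meanOfFunction] at hPf hPg ⊢
  rw [geometricMean] at hG
  rw [meanOfFunction, geometricMean.eq_def A B]
  generalize A ^ (-(1 / 2) : ℝ) * B * A ^ (-(1 / 2) : ℝ) = X at *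
  have hfi : cfc f X * cfc (fun t => (f t)⁻¹) X = 1 := by
    rw [← cfc_mul _ _ X hcf hci, ← cfc_one ℝ X hX.isSelfAdjoint]
    exact cfc_congr fun x hx => mul_inv_cancel₀ (hf.pos x (hX.spectrum_pos hx)).ne'
  have hXX : X ^ (1 / 2 : ℝ) * cfc (fun t => (f t)⁻¹) X * X ^ (1 / 2 : ℝ) =
      cfc (fun t => t / f t) X := by
    rw [rpow_conj_cfc (f := fun t => (f t)⁻¹) (hf.continuousOn.inv₀ fun x hx => (hf.pos x hx).ne') hX]
    refine cfc_congr fun x hx => ?_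
    norm_num
    ring
  refine (eq_geometricMean hPf hPg
    (A' := A ^ (-(1 / 2) : ℝ) * cfc (fun t => (f t)⁻¹) X * A ^ (-(1 / 2) : ℝ)) ?_ hG.nonneg ?_).symm
  · calc _ = A ^ (1 / 2 : ℝ) * cfc f X * (A ^ (1 / 2 : ℝ) * A ^ (-(1 / 2) : ℝ)) *
          cfc (fun t => (f t)⁻¹) X * A ^ (-(1 / 2) : ℝ) := by simp only [mul_assoc]
      _ = A ^ (1 / 2 : ℝ) * (cfc f X * cfc (fun t => (f t)⁻¹) X) * A ^ (-(1 / 2) : ℝ) := by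
          rw [rpow_half_mul_neg hA, mul_one]
          simp only [mul_assoc]
      _ = 1 := by rw [hfi, mul_one, rpow_half_mul_neg hA]
  · rw [← hXX]
    calc _ = A ^ (1 / 2 : ℝ) * X ^ (1 / 2 : ℝ) * (A ^ (1 / 2 : ℝ) * A ^ (-(1 / 2) : ℝ)) *
          cfc (fun t => (f t)⁻¹) X * (A ^ (-(1 / 2) : ℝ) * A ^ (1 / 2 : ℝ)) * X ^ (1 / 2 : ℝ) *
          A ^ (1 / 2 : ℝ) := by simp only [mul_assoc]
      _ = _ := by
          rw [rpow_half_mul_neg hA, rpow_neg_half_mul hA, mul_one, mul_one]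
          simp only [mul_assoc]

end GeometricMean

/-! ### Functional calculus of normal elements by real functions -/

section CStarAlgebra

variable {A : Type*} [CStarAlgebra A]

lemma cfc_ofReal_mul (φ ψ : ℂ → ℝ) (hφ : Continuous φ) (hψ : Continuous ψ) (a : A) :
    cfc (fun w : ℂ => (φ w : ℂ)) a * cfc (fun w : ℂ => (ψ w : ℂ)) a =
      cfc (fun w : ℂ => ((φ w * ψ w : ℝ) : ℂ)) a := by
  rw [← cfc_mul (fun w : ℂ => (φ w : ℂ)) (fun w : ℂ => (ψ w : ℂ)) a
    (Complex.continuous_ofReal.comp hφ).continuousOn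
    (Complex.continuous_ofReal.comp hψ).continuousOn]
  simp only [Complex.ofReal_mul]

lemma smul_cfc_ofReal (c : ℝ) (φ : ℂ → ℝ) (hφ : Continuous φ) (a : A) :
    c • cfc (fun w : ℂ => (φ w : ℂ)) a = cfc (fun w : ℂ => ((c * φ w : ℝ) : ℂ)) a := by
  rw [← Complex.coe_smul, ← cfc_const_mul (c : ℂ) (fun w : ℂ => (φ w : ℂ)) a
    (Complex.continuous_ofReal.comp hφ).continuousOn]
  simp only [Complex.ofReal_mul]

lemma isSelfAdjoint_cfc_ofReal (φ : ℂ → ℝ) (a : A) :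
    IsSelfAdjoint (cfc (fun w : ℂ => (φ w : ℂ)) a) := by
  rw [isSelfAdjoint_iff, ← cfc_star]
  simp only [Complex.star_def, Complex.conj_ofReal]

variable [PartialOrder A] [StarOrderedRing A]

open scoped ComplexOrder in
lemma cfc_ofReal_le_iff (φ ψ : ℂ → ℝ) (hφ : Continuous φ) (hψ : Continuous ψ) (a : A)
    (ha : IsStarNormal a) :
    cfc (fun w : ℂ => (φ w : ℂ)) a ≤ cfc (fun w : ℂ => (ψ w : ℂ)) a ↔
      ∀ w ∈ spectrum ℂ a, φ w ≤ ψ w := by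
  rw [cfc_le_iff (fun w : ℂ => (φ w : ℂ)) (fun w : ℂ => (ψ w : ℂ)) a
    (Complex.continuous_ofReal.comp hφ).continuousOn
    (Complex.continuous_ofReal.comp hψ).continuousOn ha]
  simp only [Complex.real_le_real]

/-- A self-adjoint contraction is the real part of a unitary that commutes with everything the
contraction commutes with. -/
lemma exists_mem_unitary_eq_realPart {s b : A} (hs : IsSelfAdjoint s) (hn : ‖s‖ ≤ 1)
    (hbs : Commute b s) :
    ∃ u ∈ unitary A, Commute b u ∧ s = (2⁻¹ : ℝ) • (u + star u) := by
  lift s to selfAdjoint A using hs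
  replace hn : ‖s‖ ≤ 1 := hn
  have hu := congrArg Subtype.val (selfAdjoint.realPart_unitarySelfAddISMul s hn)
  rw [realPart_apply_coe] at hu
  refine ⟨_, (selfAdjoint.unitarySelfAddISMul s hn).2, ?_, hu.symm⟩
  rw [selfAdjoint.unitarySelfAddISMul_coe]
  refine hbs.add_right (Commute.smul_right ?_ _)
  rw [CFC.sqrt_eq_cfc]
  exact (Commute.cfc_nnreal (((Commute.one_right b).sub_right (hbs.pow_right 2)).symm) _).symm

end CStarAlgebra

/-! ### The representing function of an operator mean -/

section RepresentingFunction

open ContinuousLinearMap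

variable {H : Type*} [NormedAddCommGroup H] [InnerProductSpace ℂ H] [CompleteSpace H]
  {σ : (H →L[ℂ] H) → (H →L[ℂ] H) → (H →L[ℂ] H)}

/-- For invertible `C` the transformer inequality is an equality, by applying it to `C⁻¹`. -/
lemma IsOperatorMean.transformer_eq (hσ : IsOperatorMean σ) {A B C : H →L[ℂ] H} (hA : 0 ≤ A)
    (hB : 0 ≤ B) (hC : IsUnit C) :
    star C * σ A B * C = σ (star C * A * C) (star C * B * C) := by
  refine le_antisymm (hσ.transformer A B C hA hB) ?_
  obtain ⟨D, hCD, hDC⟩ := isUnit_iff_exists.1 hC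
  have hDC' : star D * star C = 1 := by rw [← star_mul, hCD, star_one]
  have hCD' : star C * star D = 1 := by rw [← star_mul, hDC, star_one]
  have hback : ∀ M : H →L[ℂ] H, star D * (star C * M * C) * D = M := fun M => by
    calc _ = (star D * star C) * M * (C * D) := by simp only [mul_assoc]
      _ = M := by rw [hDC', hCD, one_mul, mul_one]
  have h := hσ.transformer _ _ D (star_left_conjugate_nonneg hA C) (star_left_conjugate_nonneg hB C)
  rw [hback, hback] at h
  refine le_trans (le_of_eq ?_) (star_left_conjugate_le_conjugate h C)
  calc _ = (star C * star D) * σ (star C * A * C) (star C * B * C) * (D * C) := by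
        rw [hCD', hDC, one_mul, mul_one]
    _ = _ := by simp only [mul_assoc]

lemma IsOperatorMean.commute_of_mem_unitary (hσ : IsOperatorMean σ) {B U : H →L[ℂ] H}
    (hB : 0 ≤ B) (hU : U ∈ unitary (H →L[ℂ] H)) (hBU : Commute B U) : Commute (σ 1 B) U := by
  have hUU := Unitary.star_mul_self_of_mem hU
  have hUU' := Unitary.mul_star_self_of_mem hU
  have h := hσ.transformer_eq zero_le_one hB (isUnit_iff_exists.2 ⟨star U, hUU', hUU⟩)
  rw [mul_one, hUU, mul_assoc (star U) B, hBU.eq, ← mul_assoc (star U) U, hUU, one_mul] at h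
  calc σ 1 B * U = (U * star U) * (σ 1 B * U) := by rw [hUU', one_mul]
    _ = U * (star U * σ 1 B * U) := by simp only [mul_assoc]
    _ = U * σ 1 B := by rw [h]

/-- `1 σ B` lies in the bicommutant of `B`. -/
lemma IsOperatorMean.commute_of_isSelfAdjoint (hσ : IsOperatorMean σ) {B S : H →L[ℂ] H}
    (hB : 0 ≤ B) (hS : IsSelfAdjoint S) (hBS : Commute B S) : Commute (σ 1 B) S := by
  have hc : 0 < (‖S‖ + 1)⁻¹ := by positivity
  have hn : ‖(‖S‖ + 1)⁻¹ • S‖ ≤ 1 := by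
    rw [norm_smul, Real.norm_of_nonneg hc.le, inv_mul_le_iff₀ (by positivity)]
    linarith
  obtain ⟨U, hU, hBU, hSU⟩ := exists_mem_unitary_eq_realPart ((IsSelfAdjoint.all (‖S‖ + 1)⁻¹).smul hS) hn
    (hBS.smul_right (‖S‖ + 1)⁻¹)
  have hBU' : Commute B (star U) := by
    have := hBU.star_star
    rwa [(IsSelfAdjoint.of_nonneg hB).star_eq] at this
  have h1 := hσ.commute_of_mem_unitary hB hU hBU
  have h2 := hσ.commute_of_mem_unitary hB (Unitary.star_mem hU) hBU'
  have h3 : Commute (σ 1 B) ((‖S‖ + 1)⁻¹ • S) := by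
    rw [hSU]
    exact (h1.add_right h2).smul_right _
  have h4 := h3.smul_right (‖S‖ + 1)
  rwa [smul_smul, mul_inv_cancel₀ (by positivity), one_smul] at h4

/-- The centre of the algebra of bounded operators consists of the scalars. -/
lemma exists_eq_smul_one_of_forall_commute {E : Type*} [NormedAddCommGroup E]
    [InnerProductSpace ℂ E] {T : E →L[ℂ] E} (hT : ∀ S : E →L[ℂ] E, Commute T S) :
    ∃ c : ℂ, T = c • 1 := by
  rcases subsingleton_or_nontrivial E with h | h
  · exact ⟨0, Subsingleton.elim _ _⟩
  obtain ⟨x, hx⟩ := exists_ne (0 : E)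
  have hxx : inner ℂ x x ≠ 0 := inner_self_ne_zero.2 hx
  refine ⟨inner ℂ x (T x) / inner ℂ x x, ContinuousLinearMap.ext fun y => ?_⟩
  -- commuting with the rank-one operators `y ⊗ x*` determines `T y` for every `y`
  have h := congrArg (fun S : E →L[ℂ] E => S x) (hT (InnerProductSpace.rankOne ℂ y x)).eq
  simp only [mul_apply_eq_comp, InnerProductSpace.rankOne_apply, map_smul] at h
  rw [smul_apply, one_apply_eq_self, div_eq_inv_mul, mul_smul, ← h,
    smul_smul, inv_mul_cancel₀ hxx, one_smul]

lemma coe_smul_one_eq_algebraMap {E : Type*} [NormedAddCommGroup E] [InnerProductSpace ℂ E]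
    (c : ℝ) : (c : ℂ) • (1 : E →L[ℂ] E) = algebraMap ℝ (E →L[ℂ] E) c := by
  rw [Algebra.algebraMap_eq_smul_one, Complex.coe_smul]

/-- The representing function is what its definition by choice intends: the number `c` with
`1 σ t = c` exists, since `1 σ t` commutes with every operator. -/
theorem IsOperatorMean.apply_one_algebraMap (hσ : IsOperatorMean σ) {t : ℝ} (ht : 0 ≤ t) :
    σ 1 (algebraMap ℝ _ t) = algebraMap ℝ _ (representingFunction σ t) := by
  have h0 : 0 ≤ algebraMap ℝ (H →L[ℂ] H) t := algebraMap_nonneg _ ht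
  have hcomm : ∀ S : H →L[ℂ] H, Commute (σ 1 (algebraMap ℝ _ t)) S := fun S => by
    rw [← realPart_add_I_smul_imaginaryPart S]
    exact (hσ.commute_of_isSelfAdjoint h0 (realPart S).2 (Algebra.commutes _ _)).add_right
      ((hσ.commute_of_isSelfAdjoint h0 (imaginaryPart S).2 (Algebra.commutes _ _)).smul_right _)
  obtain ⟨c, hc⟩ := exists_eq_smul_one_of_forall_commute hcomm
  have hex : ∃ r : ℝ, σ 1 ((t : ℂ) • 1) = (r : ℂ) • 1 := by
    rw [coe_smul_one_eq_algebraMap]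
    have hsa := (IsSelfAdjoint.of_nonneg (hσ.nonneg 1 _ zero_le_one h0))
    refine ⟨c.re, ?_⟩
    have h1 : (starRingEnd ℂ c) • (1 : H →L[ℂ] H) = c • 1 := by
      have := hsa.star_eq
      rwa [hc, star_smul, star_one] at this
    rw [hc]
    calc c • (1 : H →L[ℂ] H) = (2⁻¹ : ℂ) • (c • 1 + (starRingEnd ℂ c) • 1) := by rw [h1]; module
      _ = (2⁻¹ * (c + starRingEnd ℂ c)) • 1 := by module
      _ = (c.re : ℂ) • 1 := by
        rw [Complex.add_conj]
        congr 1
        push_cast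
        ring
  have h : σ 1 ((t : ℂ) • 1) = (representingFunction σ t : ℂ) • 1 := Classical.epsilon_spec hex
  rwa [coe_smul_one_eq_algebraMap, coe_smul_one_eq_algebraMap] at h

lemma IsOperatorMean.conj_algebraMap (hσ : IsOperatorMean σ) {C : H →L[ℂ] H} (hC : IsUnit C)
    (hCs : IsSelfAdjoint C) {t : ℝ} (ht : 0 ≤ t) :
    σ (C * C) (t • (C * C)) = representingFunction σ t • (C * C) := by
  have h := hσ.transformer_eq zero_le_one (algebraMap_nonneg (H →L[ℂ] H) ht) hC
  rw [hσ.apply_one_algebraMap ht, hCs.star_eq, Algebra.algebraMap_eq_smul_one,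
    Algebra.algebraMap_eq_smul_one] at h
  simpa only [mul_smul_comm, smul_mul_assoc, mul_one] using h.symm

/-- Homogeneity of `σ` on scalar operators. -/
lemma IsOperatorMean.apply_algebraMap (hσ : IsOperatorMean σ) {s t : ℝ} (hs : 0 < s)
    (ht : 0 ≤ t) : σ (algebraMap ℝ _ s) (algebraMap ℝ _ (s * t)) =
      algebraMap ℝ _ (s * representingFunction σ t) := by
  have hu : IsUnit (algebraMap ℝ (H →L[ℂ] H) (√s)) :=
    ((Real.sqrt_pos.2 hs).ne'.isUnit).map _
  have hsa : IsSelfAdjoint (algebraMap ℝ (H →L[ℂ] H) (√s)) :=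
    (IsSelfAdjoint.all (√s)).algebraMap _
  have h := hσ.conj_algebraMap hu hsa ht
  rw [← map_mul, Real.mul_self_sqrt hs.le] at h
  rw [mul_comm s t, mul_comm s, map_mul, map_mul, ← Algebra.smul_def, ← Algebra.smul_def]
  exact h

lemma IsOperatorMean.isQuasiconcave [Nontrivial H] (hσ : IsOperatorMean σ) :
    IsQuasiconcave (representingFunction σ) := by
  have h0 : ∀ t : ℝ, 0 ≤ t → 0 ≤ algebraMap ℝ (H →L[ℂ] H) t := fun t ht => algebraMap_nonneg _ ht
  have hle : ∀ s t : ℝ, algebraMap ℝ (H →L[ℂ] H) s ≤ algebraMap ℝ _ t ↔ s ≤ t := fun s t =>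
    algebraMap_le_algebraMap
  have h1 : representingFunction σ 1 = 1 := by
    have h := hσ.apply_one_algebraMap zero_le_one
    rw [map_one, hσ.one_one, ← map_one (algebraMap ℝ (H →L[ℂ] H))] at h
    exact (FaithfulSMul.algebraMap_injective ℝ (H →L[ℂ] H) h).symm
  have hmono : ∀ s t, 0 < s → s ≤ t → representingFunction σ s ≤ representingFunction σ t := by
    intro s t hs hst
    have h := hσ.mono 1 1 _ _ zero_le_one (h0 s hs.le) le_rfl ((hle s t).2 hst)
    rwa [hσ.apply_one_algebraMap hs.le, hσ.apply_one_algebraMap (hs.le.trans hst), hle] at h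
  have hmul : ∀ s t, 0 < s → s ≤ t →
      representingFunction σ t * s ≤ representingFunction σ s * t := by
    intro s t hs hst
    have ht := hs.trans_le hst
    have h := hσ.mono _ _ _ _ (h0 s hs.le) (h0 (s * t) (by positivity)) ((hle s t).2 hst) le_rfl
    rw [hσ.apply_algebraMap hs ht.le, mul_comm s t, hσ.apply_algebraMap ht hs.le, hle] at h
    linarith
  refine ⟨fun t ht => ?_, hmono, hmul⟩
  rcases le_total 1 t with h | h
  · linarith [hmono 1 t one_pos h]
  · nlinarith [hmul t 1 ht h]

/-- If `X ≤ μ` locally on the support of `C`, then `1 σ X ≤ f(μ)` there. As `C` need not be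
invertible, `C²` is replaced by `C² + ε` and `ε` tends to `0`. -/
lemma IsOperatorMean.conj_apply_le (hσ : IsOperatorMean σ) {X C : H →L[ℂ] H} {μ : ℝ}
    (hX : 0 ≤ X) (hμ : 0 ≤ μ) (hC : IsSelfAdjoint C) (h : C * X * C ≤ μ • (C * C)) :
    C * σ 1 X * C ≤ representingFunction σ μ • (C * C) := by
  have hCC : 0 ≤ C * C := by simpa [hC.star_eq] using star_mul_self_nonneg C
  have key : ∀ ε : ℝ, 0 < ε →
      C * σ 1 X * C ≤ representingFunction σ μ • (C * C + algebraMap ℝ _ ε) := by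
    intro ε hε
    have hp : IsStrictlyPositive (C * C + algebraMap ℝ (H →L[ℂ] H) ε) :=
      (isStrictlyPositive_algebraMap hε).nonneg_add hCC
    have hE := hσ.conj_algebraMap hp.isUnit_cfcSqrt
      (IsSelfAdjoint.of_nonneg (CFC.sqrt_nonneg _)) hμ
    rw [CFC.sqrt_mul_sqrt_self _ hp.nonneg] at hE
    have h1 := hσ.transformer 1 X C zero_le_one hX
    have h2 : 0 ≤ C * X * C := by simpa [hC.star_eq] using star_left_conjugate_nonneg hX C
    rw [hC.star_eq, mul_one] at h1
    rw [← hE]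
    refine h1.trans (hσ.mono _ _ _ _ hCC h2 (le_add_of_nonneg_right (algebraMap_nonneg _ hε.le))
      (h.trans ?_))
    exact smul_le_smul_of_nonneg_left (le_add_of_nonneg_right (algebraMap_nonneg _ hε.le)) hμ
  have ht : Tendsto (fun ε : ℝ => representingFunction σ μ • (C * C + algebraMap ℝ _ ε) -
      C * σ 1 X * C) (𝓝[>] 0) (𝓝 (representingFunction σ μ • (C * C) - C * σ 1 X * C)) := by
    have : ContinuousAt (fun ε : ℝ => representingFunction σ μ •
        (C * C + algebraMap ℝ (H →L[ℂ] H) ε) - C * σ 1 X * C) 0 := by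
      simp only [Algebra.algebraMap_eq_smul_one]
      fun_prop
    simpa [ContinuousAt] using this.tendsto.mono_left nhdsWithin_le_nhds
  rw [← sub_nonneg]
  exact CStarAlgebra.isClosed_nonneg.mem_of_tendsto ht
    (eventually_mem_nhdsWithin.mono fun ε hε => sub_nonneg.2 (key ε hε))

/-- If `μ ≤ X` locally on the support of `D`, then `f(μ) ≤ 1 σ X` there. -/
lemma IsOperatorMean.smul_le_apply (hσ : IsOperatorMean σ) {X D : H →L[ℂ] H} {μ : ℝ}
    (hμ : 0 ≤ μ) (hD : IsSelfAdjoint D) (hDD : D * D ≤ 1) (hDX : μ • (D * D) ≤ X) :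
    representingFunction σ μ • (D * D) ≤ σ 1 X := by
  have h0 : 0 ≤ D * D := by simpa [hD.star_eq] using star_mul_self_nonneg D
  have h1 := hσ.transformer 1 (algebraMap ℝ _ μ) D zero_le_one (algebraMap_nonneg _ hμ)
  rw [hσ.apply_one_algebraMap hμ, hD.star_eq, Algebra.algebraMap_eq_smul_one,
    Algebra.algebraMap_eq_smul_one] at h1
  simp only [mul_smul_comm, smul_mul_assoc, mul_one] at h1
  exact h1.trans (hσ.mono _ _ _ _ h0 (smul_nonneg hμ h0) hDD hDX)

/-- `1 σ X = f(X)` for the representing function `f`. The usual proof cuts `X` down by spectral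
projections; here bump functions of the normal operator `X + i (1 σ X)` play their role. -/
theorem IsOperatorMean.apply_one [Nontrivial H] (hσ : IsOperatorMean σ) {X : H →L[ℂ] H}
    (hX : IsStrictlyPositive X) : σ 1 X = cfc (representingFunction σ) X := by
  have hqc := hσ.isQuasiconcave
  obtain ⟨f, hf⟩ : ∃ f, f = representingFunction σ := ⟨_, rfl⟩
  rw [← hf] at hqc ⊢
  obtain ⟨T, hT⟩ : ∃ T, T = σ 1 X := ⟨_, rfl⟩
  have hTs : IsSelfAdjoint T := hT ▸ IsSelfAdjoint.of_nonneg (hσ.nonneg 1 X zero_le_one hX.nonneg)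
  have hXT : Commute X T := by
    rw [hT]
    exact (hσ.commute_of_isSelfAdjoint hX.nonneg hX.isSelfAdjoint (Commute.refl X)).symm
  -- `Z = X + iT` is normal, and its spectrum is the joint spectrum of `X` and `T`
  obtain ⟨Z, hZ⟩ : ∃ Z, Z = X + Complex.I • T := ⟨_, rfl⟩
  have hre : ((realPart Z : selfAdjoint (H →L[ℂ] H)) : H →L[ℂ] H) = X := by
    rw [hZ, map_add, realPart_I_smul, hTs.imaginaryPart, neg_zero, add_zero,
      hX.isSelfAdjoint.coe_realPart]
  have him : ((imaginaryPart Z : selfAdjoint (H →L[ℂ] H)) : H →L[ℂ] H) = T := by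
    rw [hZ, map_add, imaginaryPart_I_smul, hX.isSelfAdjoint.imaginaryPart, zero_add,
      hTs.coe_realPart]
  have hZn : IsStarNormal Z := by
    rw [isStarNormal_iff_commute_realPart_imaginaryPart, hre, him]
    exact hXT
  have hXZ : cfc (fun z : ℂ => (z.re : ℂ)) Z = X := by rw [cfc_re_id Z, hre]
  have hTZ : cfc (fun z : ℂ => (z.im : ℂ)) Z = T := by rw [cfc_im_id Z, him]
  have hcont : ContinuousOn f (spectrum ℝ X) := hqc.continuousOn.cfc_spectrum hX
  have hreZ : ∀ z ∈ spectrum ℂ Z, 0 < z.re := by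
    intro z hz
    have h1 : (z.re : ℂ) ∈ spectrum ℂ X := by
      rw [← hXZ, cfc_map_spectrum (fun z : ℂ => (z.re : ℂ)) Z]
      exact ⟨z, hz, rfl⟩
    exact hX.spectrum_pos ((spectrum.algebraMap_mem_iff ℂ).1 h1)
  have key : ∀ z ∈ spectrum ℂ Z, ∀ δ : ℝ, 0 < δ → δ < z.re →
      z.im ≤ f (z.re + δ) ∧ f (z.re - δ) ≤ z.im := by
    intro z hz δ hδ hδz
    -- a bump function of `Z`, equal to `1` at `z` and zero where `|re - re z| ≥ δ`
    obtain ⟨φ, hφ⟩ : ∃ φ : ℂ → ℝ, φ = fun w => max 0 (1 - |w.re - z.re| / δ) := ⟨_, rfl⟩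
    have hφc : Continuous φ := by rw [hφ]; fun_prop
    have hφz : φ z = 1 := by simp [hφ]
    have hφ0 : ∀ w, 0 ≤ φ w := fun w => by rw [hφ]; exact le_max_left _ _
    have hφ1 : ∀ w, φ w ≤ 1 := fun w => by
      rw [hφ]
      exact max_le zero_le_one (sub_le_self _ (by positivity))
    have hφs : ∀ w, φ w = 0 ∨ |w.re - z.re| < δ := fun w => by
      rcases lt_or_ge |w.re - z.re| δ with h | h
      · exact .inr h
      · left
        rw [hφ]
        refine max_eq_left ?_
        have := (one_le_div hδ).2 h
        linarith
    obtain ⟨C, hC⟩ : ∃ C, C = cfc (fun w : ℂ => (φ w : ℂ)) Z := ⟨_, rfl⟩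
    have hCs : IsSelfAdjoint C := hC ▸ isSelfAdjoint_cfc_ofReal φ Z
    have hCC : C * C = cfc (fun w : ℂ => ((φ w * φ w : ℝ) : ℂ)) Z := by
      rw [hC, cfc_ofReal_mul φ φ hφc hφc]
    have hsmul : ∀ c : ℝ, c • (C * C) = cfc (fun w : ℂ => ((c * (φ w * φ w) : ℝ) : ℂ)) Z := by
      intro c
      rw [hCC, smul_cfc_ofReal c (fun w => φ w * φ w) (hφc.mul hφc)]
    have hconj : ∀ (ψ : ℂ → ℝ), Continuous ψ → C * cfc (fun w : ℂ => (ψ w : ℂ)) Z * C =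
        cfc (fun w : ℂ => ((φ w * ψ w * φ w : ℝ) : ℂ)) Z := by
      intro ψ hψ
      rw [hC, cfc_ofReal_mul φ ψ hφc hψ,
        cfc_ofReal_mul (fun w => φ w * ψ w) φ (hφc.mul hψ) hφc]
    have hle : ∀ φ ψ : ℂ → ℝ, Continuous φ → Continuous ψ →
        (cfc (fun w : ℂ => (φ w : ℂ)) Z ≤ cfc (fun w : ℂ => (ψ w : ℂ)) Z ↔
          ∀ w ∈ spectrum ℂ Z, φ w ≤ ψ w) := 
      fun φ ψ hφ hψ => cfc_ofReal_le_iff φ ψ hφ hψ Z hZn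
    have hcφφ : ∀ c : ℝ, Continuous fun w => c * (φ w * φ w) := fun c => by fun_prop
    constructor
    · have h1 : C * X * C ≤ (z.re + δ) • (C * C) := by
        rw [hsmul, ← hXZ, hconj Complex.re Complex.continuous_re,
          hle (fun w => φ w * w.re * φ w) _ (by fun_prop) (hcφφ _)]
        intro w hw
        rcases hφs w with h | h
        · simp [h]
        · have h2 : w.re ≤ z.re + δ := by linarith [(abs_lt.1 h).2]
          nlinarith [mul_nonneg (hφ0 w) (hφ0 w)]
      have h2 := hσ.conj_apply_le hX.nonneg (by linarith) hCs h1
      rw [← hf, ← hT, ← hTZ, hsmul, hconj Complex.im Complex.continuous_im,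
        hle (fun w => φ w * w.im * φ w) _ (by fun_prop) (hcφφ _)] at h2
      have h3 := h2 z hz
      rw [hφz] at h3
      linarith
    · have h0 : C * C ≤ 1 := by
        have : (1 : H →L[ℂ] H) = cfc (fun _ : ℂ => ((1 : ℝ) : ℂ)) Z := by
          rw [Complex.ofReal_one]
          exact (cfc_const_one ℂ Z).symm
        rw [this, hCC, hle (fun w => φ w * φ w) (fun _ => 1) (by fun_prop) (by fun_prop)]
        intro w hw
        nlinarith [hφ0 w, hφ1 w]
      have h1 : (z.re - δ) • (C * C) ≤ X := by
        rw [hsmul, ← hXZ, hle _ _ (hcφφ _) Complex.continuous_re]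
        intro w hw
        have hw0 := hreZ w hw
        rcases hφs w with h | h
        · simp [h, hw0.le]
        · have h2 : z.re - δ ≤ w.re := by linarith [(abs_lt.1 h).1]
          have h3 : φ w * φ w ≤ 1 := mul_le_one₀ (hφ1 w) (hφ0 w) (hφ1 w)
          exact (mul_le_of_le_one_right (by linarith) h3).trans h2
      have h2 := hσ.smul_le_apply (by linarith) hCs h0 h1
      rw [← hf, ← hT, ← hTZ, hsmul, hle _ _ (hcφφ _) Complex.continuous_im] at h2
      have h3 := h2 z hz
      rw [hφz] at h3
      linarith
  rw [← hT, ← hTZ, ← hre, ← cfc_comp_re f Z (by rwa [hre]) hZn]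
  refine cfc_congr fun z hz => ?_
  have hz0 := hreZ z hz
  have hfc : ContinuousAt f z.re := hqc.continuousOn.continuousAt (Ioi_mem_nhds hz0)
  have hev : ∀ᶠ δ : ℝ in 𝓝[>] 0, 0 < δ ∧ δ < z.re :=
    eventually_mem_nhdsWithin.and (mem_nhdsWithin_of_mem_nhds (Iio_mem_nhds hz0))
  have h1 : Tendsto (fun δ => f (z.re + δ)) (𝓝[>] 0) (𝓝 (f z.re)) := by
    have : ContinuousAt (fun δ => f (z.re + δ)) 0 :=
      ContinuousAt.comp (by simpa using hfc) (by fun_prop)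
    simpa [ContinuousAt] using this.tendsto.mono_left nhdsWithin_le_nhds
  have h2 : Tendsto (fun δ => f (z.re - δ)) (𝓝[>] 0) (𝓝 (f z.re)) := by
    have : ContinuousAt (fun δ => f (z.re - δ)) 0 :=
      ContinuousAt.comp (by simpa using hfc) (by fun_prop)
    simpa [ContinuousAt] using this.tendsto.mono_left nhdsWithin_le_nhds
  exact congrArg Complex.ofReal (le_antisymm
    (ge_of_tendsto h1 (hev.mono fun δ hδ => (key z hz δ hδ.1 hδ.2).1))
    (le_of_tendsto h2 (hev.mono fun δ hδ => (key z hz δ hδ.1 hδ.2).2)))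

/-- The Kubo–Ando formula `A σ B = A^{1/2} f(A^{-1/2} B A^{-1/2}) A^{1/2}`. -/
theorem IsOperatorMean.eq_meanOfFunction [Nontrivial H] (hσ : IsOperatorMean σ)
    {A B : H →L[ℂ] H} (hA : IsStrictlyPositive A) (hB : IsStrictlyPositive B) :
    σ A B = meanOfFunction (representingFunction σ) A B := by
  have hX := isStrictlyPositive_rpow_conj hA hB (-(1 / 2))
  have h := hσ.transformer_eq zero_le_one hX.nonneg (IsStrictlyPositive.rpow A (1 / 2) hA).isUnit
  rw [hσ.apply_one hX, star_rpow, mul_one, rpow_half_mul_self hA] at h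
  rw [meanOfFunction, h]
  congr 1
  calc B = (A ^ (1 / 2 : ℝ) * A ^ (-(1 / 2) : ℝ)) * B * (A ^ (-(1 / 2) : ℝ) * A ^ (1 / 2 : ℝ)) := by
        rw [rpow_half_mul_neg hA, rpow_neg_half_mul hA, mul_one, one_mul]
    _ = _ := by simp only [mul_assoc]

end RepresentingFunction

/-! ### Doubling a Hilbert space -/

section Isometries

open ContinuousLinearMap

variable {H : Type*} [NormedAddCommGroup H] [InnerProductSpace ℂ H] [CompleteSpace H]
  {K : Type*} [NormedAddCommGroup K] [InnerProductSpace ℂ K] [CompleteSpace K]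

/-- A Hilbert basis can be mapped to any orthonormal family by an isometry. -/
lemma HilbertBasis.exists_isometry {ι : Type*} (b : HilbertBasis ι ℂ H) {u : ι → K}
    (hu : Orthonormal ℂ u) : ∃ V : H →L[ℂ] K, adjoint V ∘L V = 1 ∧ ∀ i, V (b i) = u i := by
  classical
  obtain ⟨W, hW⟩ : ∃ W, W = hu.orthogonalFamily.linearIsometry.comp b.repr.toLinearIsometry :=
    ⟨_, rfl⟩
  refine ⟨W.toContinuousLinearMap, ?_, fun i => ?_⟩
  · refine ContinuousLinearMap.ext fun x => ext_inner_left ℂ fun y => ?_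
    rw [comp_apply, adjoint_inner_right]
    exact W.inner_map_map y x
  · change W (b i) = u i
    rw [hW]
    change hu.orthogonalFamily.linearIsometry (b.repr (b i)) = u i
    rw [b.repr_self, OrthogonalFamily.linearIsometry_apply_single]
    simp

lemma HilbertBasis.hasOrthogonalIsometries {ι : Type*} (b : HilbertBasis ι ℂ H)
    {v : ι ⊕ ι → K} (hv : Orthonormal ℂ v) : HasOrthogonalIsometries H K := by
  classical
  obtain ⟨V₁, h₁, hb₁⟩ := b.exists_isometry (hv.comp _ Sum.inl_injective)
  obtain ⟨V₂, h₂, hb₂⟩ := b.exists_isometry (hv.comp _ Sum.inr_injective)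
  refine ⟨V₁, V₂, h₁, h₂, ?_⟩
  have hdense : Dense (Submodule.span ℂ (Set.range b) : Set H) := by
    rw [Submodule.dense_iff_topologicalClosure_eq_top]
    exact b.dense_span
  refine ContinuousLinearMap.ext_on hdense ?_
  rintro _ ⟨j, rfl⟩
  refine b.repr.injective ?_
  ext i
  rw [b.repr_apply_apply, b.repr_apply_apply, comp_apply, adjoint_inner_right, hb₁, hb₂]
  simp only [Function.comp_apply, zero_apply, inner_zero_right]
  exact hv.2 (by simp)

lemma hasOrthogonalIsometries_self (h : ¬ FiniteDimensional ℂ H) :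
    HasOrthogonalIsometries H H := by
  obtain ⟨w, b, -⟩ := exists_hilbertBasis ℂ H
  have hw : Infinite w := by
    by_contra hfin
    rw [not_infinite_iff_finite] at hfin
    have := Fintype.ofFinite w
    exact h b.toOrthonormalBasis.toBasis.finiteDimensional_of_finite
  obtain ⟨e⟩ : Nonempty (w ⊕ w ≃ w) := by
    rw [← Cardinal.eq, Cardinal.mk_sum, Cardinal.lift_id]
    exact Cardinal.add_eq_self (Cardinal.infinite_iff.1 hw)
  exact b.hasOrthogonalIsometries (b.orthonormal.comp _ e.injective)

lemma hasOrthogonalIsometries_euclideanSpace {n : ℕ} (b : OrthonormalBasis (Fin n) ℂ H) :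
    HasOrthogonalIsometries H (EuclideanSpace ℂ (Fin (n + n))) :=
  b.toHilbertBasis.hasOrthogonalIsometries
    ((EuclideanSpace.basisFun (Fin (n + n)) ℂ).orthonormal.comp _ finSumFinEquiv.injective)

end Isometries

/-! ### The inequalities between sums of means -/

section MainInequalities

variable {H : Type*} [NormedAddCommGroup H] [InnerProductSpace ℂ H] [CompleteSpace H]
  {K : Type*} [NormedAddCommGroup K] [InnerProductSpace ℂ K] [CompleteSpace K]
  {σ : (H →L[ℂ] H) → (H →L[ℂ] H) → (H →L[ℂ] H)}

/-- The two inequalities for the mean with representing function `f`. -/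
theorem geometricMean_sum_bounds {f : ℝ → ℝ} (hf : IsQuasiconcave f)
    (hHK : HasOrthogonalIsometries H K) (hfK : IsMonotoneOnStrictlyPositive K f)
    (hgK : IsMonotoneOnStrictlyPositive K fun t => t / f t)
    {ι : Type*} {s : Finset ι} (hs : s.Nonempty) {A B : ι → H →L[ℂ] H}
    (hA : ∀ j, IsStrictlyPositive (A j)) (hB : ∀ j, IsStrictlyPositive (B j)) :
    ∑ j ∈ s, geometricMean (A j) (B j) ≤
        geometricMean (∑ j ∈ s, meanOfFunction f (A j) (B j))
          (∑ j ∈ s, meanOfFunction (fun t => t / f t) (A j) (B j)) ∧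
      geometricMean (∑ j ∈ s, meanOfFunction f (A j) (B j))
          (∑ j ∈ s, meanOfFunction (fun t => t / f t) (A j) (B j)) ≤
        geometricMean (∑ j ∈ s, A j) (∑ j ∈ s, B j) := by
  have hP : ∀ j, IsStrictlyPositive (meanOfFunction f (A j) (B j)) := fun j =>
    isStrictlyPositive_meanOfFunction hf (hA j) (hB j)
  have hQ : ∀ j, IsStrictlyPositive (meanOfFunction (fun t => t / f t) (A j) (B j)) := fun j =>
    isStrictlyPositive_meanOfFunction hf.id_div (hA j) (hB j)
  have hsumA := isStrictlyPositive_sum hs hA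
  have hsumB := isStrictlyPositive_sum hs hB
  have hsumP := isStrictlyPositive_sum hs hP
  have hsumQ := isStrictlyPositive_sum hs hQ
  constructor
  · have h := sum_meanOfFunction_le IsQuasiconcave.sqrt hHK isMonotoneOnStrictlyPositive_sqrt
      hs hP hQ
    rw [← geometricMean_eq_meanOfFunction hsumP hsumQ] at h
    refine le_trans (le_of_eq (Finset.sum_congr rfl fun j _ => ?_)) h
    rw [← geometricMean_eq_meanOfFunction (hP j) (hQ j),
      geometricMean_meanOfFunction hf (hA j) (hB j)]
  · rw [← geometricMean_meanOfFunction hf hsumA hsumB]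
    exact geometricMean_mono hsumP hsumQ (sum_meanOfFunction_le hf hHK hfK hs hA hB)
      (sum_meanOfFunction_le hf.id_div hHK hgK hs hA hB)

lemma IsOperatorMean.isMonotoneOnStrictlyPositive [Nontrivial H] (hσ : IsOperatorMean σ) :
    IsMonotoneOnStrictlyPositive H (representingFunction σ) := by
  intro S T hS hST
  rw [← hσ.apply_one hS, ← hσ.apply_one (hS.of_le hST)]
  exact hσ.mono 1 1 S T zero_le_one hS.nonneg le_rfl hST

/-- On a finite-dimensional space, monotonicity in higher dimensions is part of the definition. -/
lemma IsOperatorMean.isMonotoneOnStrictlyPositive_euclideanSpace [Nontrivial H]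
    (hσ : IsOperatorMean σ) (hH : FiniteDimensional ℂ H) (n : ℕ) :
    IsMonotoneOnStrictlyPositive (EuclideanSpace ℂ (Fin n)) (representingFunction σ) := by
  obtain ⟨f, hf, hσf⟩ := hσ.operatorMonotone_of_finiteDimensional hH
  have heq : ∀ t : ℝ, 0 ≤ t → representingFunction σ t = f t := by
    intro t ht
    have h := hσf t ht
    rw [coe_smul_one_eq_algebraMap, coe_smul_one_eq_algebraMap, hσ.apply_one_algebraMap ht] at h
    exact FaithfulSMul.algebraMap_injective ℝ (H →L[ℂ] H) h
  intro S T hS hST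
  have hT := hS.of_le hST
  rw [cfc_congr fun x hx => heq x (hS.spectrum_pos hx).le,
    cfc_congr fun x hx => heq x (hT.spectrum_pos hx).le]
  exact hf n S T hS.nonneg hST

/-- The two inequalities for an operator mean. The dual mean uses up one doubling of the space and
superadditivity another one, so that `f` has to be monotone on a space that contains four copies
of `H`; for infinite-dimensional `H` this is `H` itself. -/
theorem IsOperatorMean.geometricMean_sum_bounds [Nontrivial H] (hσ : IsOperatorMean σ)
    {ι : Type*} {s : Finset ι} (hs : s.Nonempty) {A B : ι → H →L[ℂ] H}
    (hA : ∀ j, IsStrictlyPositive (A j)) (hB : ∀ j, IsStrictlyPositive (B j)) :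
    ∑ j ∈ s, geometricMean (A j) (B j) ≤
        geometricMean (∑ j ∈ s, σ (A j) (B j)) (∑ j ∈ s, dualMean σ (A j) (B j)) ∧
      geometricMean (∑ j ∈ s, σ (A j) (B j)) (∑ j ∈ s, dualMean σ (A j) (B j)) ≤
        geometricMean (∑ j ∈ s, A j) (∑ j ∈ s, B j) := by
  have hqc := hσ.isQuasiconcave
  rw [Finset.sum_congr rfl fun j _ => hσ.eq_meanOfFunction (hA j) (hB j)]
  unfold dualMean
  by_cases hH : FiniteDimensional ℂ H
  · have hHK := hasOrthogonalIsometries_euclideanSpace (stdOrthonormalBasis ℂ H)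
    have hKL := hasOrthogonalIsometries_euclideanSpace
      (EuclideanSpace.basisFun (Fin (Module.finrank ℂ H + Module.finrank ℂ H)) ℂ)
    have hmono := hσ.isMonotoneOnStrictlyPositive_euclideanSpace hH
    exact _root_.geometricMean_sum_bounds hqc hHK (hmono _)
      (.id_div hqc hKL (hmono _) (hmono _)) hs hA hB
  · have hHH := hasOrthogonalIsometries_self hH
    have hmono := hσ.isMonotoneOnStrictlyPositive
    exact _root_.geometricMean_sum_bounds hqc hHH hmono (.id_div hqc hHH hmono hmono) hs hA hB

end MainInequalities

/-! ### Interpolational paths -/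

section InterpolationalPath

variable {H : Type*} [NormedAddCommGroup H] [InnerProductSpace ℂ H] [CompleteSpace H]
  {σ : (H →L[ℂ] H) → (H →L[ℂ] H) → (H →L[ℂ] H)}
  {τ : ℝ → (H →L[ℂ] H) → (H →L[ℂ] H) → (H →L[ℂ] H)}

lemma IsOperatorMean.isStrictlyPositive_apply [Nontrivial H] (hσ : IsOperatorMean σ)
    {A B : H →L[ℂ] H} (hA : IsStrictlyPositive A) (hB : IsStrictlyPositive B) :
    IsStrictlyPositive (σ A B) := by
  rw [hσ.eq_meanOfFunction hA hB]
  exact isStrictlyPositive_meanOfFunction hσ.isQuasiconcave hA hB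

/-- A closed set that contains `0`, `1` and all midpoints of its elements contains `[0, 1]`. -/
lemma Icc_subset_of_isClosed_of_midpoint_mem {S : Set ℝ} (hS : IsClosed S) (h0 : 0 ∈ S)
    (h1 : 1 ∈ S) (hmid : ∀ a ∈ S, ∀ b ∈ S, (a + b) / 2 ∈ S) : Icc (0 : ℝ) 1 ⊆ S := by
  have hdy : ∀ n k : ℕ, k ≤ 2 ^ n → (k : ℝ) / 2 ^ n ∈ S := by
    intro n
    induction n with
    | zero =>
      intro k hk
      have hk' : k ≤ 1 := by simpa using hk
      interval_cases k <;> simpa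
    | succ n ih =>
      intro k hk
      rw [pow_succ] at hk
      have h := hmid _ (ih (k / 2) (by omega)) _ (ih (k - k / 2) (by omega))
      convert h using 1
      rw [Nat.cast_sub (Nat.div_le_self k 2), pow_succ]
      field_simp
      ring
  intro r hr
  have hlim : Tendsto (fun n : ℕ => (⌊r * 2 ^ n⌋₊ : ℝ) / 2 ^ n) atTop (𝓝 r) := by
    have h2 : Tendsto (fun n : ℕ => (2 : ℝ) ^ n) atTop atTop :=
      tendsto_pow_atTop_atTop_of_one_lt one_lt_two
    exact (tendsto_nat_floor_mul_div_atTop hr.1).comp h2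
  refine hS.mem_of_tendsto hlim (Eventually.of_forall fun n => hdy n _ ?_)
  have h2 : (0 : ℝ) < 2 ^ n := by positivity
  have : (⌊r * 2 ^ n⌋₊ : ℝ) ≤ 2 ^ n :=
    (Nat.floor_le (mul_nonneg hr.1 h2.le)).trans (mul_le_of_le_one_left h2.le hr.2)
  exact_mod_cast this

/-- The path from `A σ_p B` to `A σ_q B` is a part of the path from `A` to `B`. -/
lemma IsInterpolationalPath.reparam [Nontrivial H] (hτ : IsInterpolationalPath σ τ)
    {A B : H →L[ℂ] H} (hA : IsStrictlyPositive A) (hB : IsStrictlyPositive B) {p q : ℝ}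
    (hp : p ∈ Icc (0 : ℝ) 1) (hq : q ∈ Icc (0 : ℝ) 1) {r : ℝ} (hr : r ∈ Icc (0 : ℝ) 1) :
    τ r (τ p A B) (τ q A B) = τ ((1 - r) * p + r * q) A B := by
  obtain ⟨X, hX⟩ : ∃ X, X = τ p A B := ⟨_, rfl⟩
  obtain ⟨Y, hY⟩ : ∃ Y, Y = τ q A B := ⟨_, rfl⟩
  have hXp : IsStrictlyPositive X := hX ▸ (hτ.isOperatorMean p hp).isStrictlyPositive_apply hA hB
  have hYp : IsStrictlyPositive Y := hY ▸ (hτ.isOperatorMean q hq).isStrictlyPositive_apply hA hB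
  have hmem : ∀ r ∈ Icc (0 : ℝ) 1, (1 - r) * p + r * q ∈ Icc (0 : ℝ) 1 := fun r hr =>
    convex_Icc 0 1 hp hq (by linarith [hr.2]) hr.1 (by ring)
  have hclosed : IsClosed {r ∈ Icc (0 : ℝ) 1 | τ r X Y = τ ((1 - r) * p + r * q) A B} := by
    have h1 := hτ.continuousOn X Y hXp hYp
    have h2 : ContinuousOn (fun r => τ ((1 - r) * p + r * q) A B) (Icc (0 : ℝ) 1) :=
      (hτ.continuousOn A B hA hB).comp (f := fun r : ℝ => (1 - r) * p + r * q)
        (by fun_prop) hmem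
    have := (h1.sub h2).preimage_isClosed_of_isClosed isClosed_Icc
      (isClosed_singleton (x := (0 : H →L[ℂ] H)))
    convert this using 1
    ext r
    simp [sub_eq_zero]
  have hall := Icc_subset_of_isClosed_of_midpoint_mem hclosed
    ⟨by simp, by rw [hτ.zero X Y hXp hYp, hX]; congr 1; ring⟩
    ⟨by simp, by rw [hτ.one X Y hXp hYp, hY]; congr 1; ring⟩ (by
      rintro a ⟨ha, ha'⟩ b ⟨hb, hb'⟩
      refine ⟨⟨by linarith [ha.1, hb.1], by linarith [ha.2, hb.2]⟩, ?_⟩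
      rw [← hτ.midpoint X Y hXp hYp a ha b hb, ha', hb',
        hτ.midpoint A B hA hB _ (hmem a ha) _ (hmem b hb)]
      congr 1
      ring)
  rw [← hX, ← hY]
  exact (hall hr).2

/-- Monotonicity along a self-dual path: with `s = (1 - r) t + r (1 - t)`, this is the second of the
two inequalities for the mean `σ_r` and the operators `A_j σ_t B_j`, `A_j σ_{1-t} B_j`. -/
theorem IsInterpolationalPath.geometricMean_sum_le [Nontrivial H]
    (hτ : IsInterpolationalPath σ τ)
    (hdual : ∀ t ∈ Icc (0 : ℝ) 1, ∀ X Y : H →L[ℂ] H, IsStrictlyPositive X →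
      IsStrictlyPositive Y → dualMean (τ t) X Y = τ (1 - t) X Y)
    {ι : Type*} {F : Finset ι} (hF : F.Nonempty) {A B : ι → H →L[ℂ] H}
    (hA : ∀ j, IsStrictlyPositive (A j)) (hB : ∀ j, IsStrictlyPositive (B j))
    {t s : ℝ} (ht : t ∈ Icc (0 : ℝ) 1) (hs : s ∈ uIcc t (1 - t)) :
    geometricMean (∑ j ∈ F, τ s (A j) (B j)) (∑ j ∈ F, τ (1 - s) (A j) (B j)) ≤
      geometricMean (∑ j ∈ F, τ t (A j) (B j)) (∑ j ∈ F, τ (1 - t) (A j) (B j)) := by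
  have ht' : 1 - t ∈ Icc (0 : ℝ) 1 := ⟨by linarith [ht.2], by linarith [ht.1]⟩
  obtain ⟨r, hr, rfl⟩ : ∃ r ∈ Icc (0 : ℝ) 1, (1 - r) * t + r * (1 - t) = s := by
    rw [← segment_eq_uIcc, segment_eq_image] at hs
    exact hs
  have hr' : 1 - r ∈ Icc (0 : ℝ) 1 := ⟨by linarith [hr.2], by linarith [hr.1]⟩
  have hX : ∀ j, IsStrictlyPositive (τ t (A j) (B j)) := fun j =>
    (hτ.isOperatorMean t ht).isStrictlyPositive_apply (hA j) (hB j)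
  have hY : ∀ j, IsStrictlyPositive (τ (1 - t) (A j) (B j)) := fun j =>
    (hτ.isOperatorMean _ ht').isStrictlyPositive_apply (hA j) (hB j)
  have h := ((hτ.isOperatorMean r hr).geometricMean_sum_bounds hF hX hY).2
  rw [Finset.sum_congr rfl fun j _ => hdual r hr _ _ (hX j) (hY j),
    Finset.sum_congr rfl fun j _ => hτ.reparam (hA j) (hB j) ht ht' hr,
    Finset.sum_congr rfl fun j _ => hτ.reparam (hA j) (hB j) ht ht' hr',
    show (1 - (1 - r)) * t + (1 - r) * (1 - t) = 1 - ((1 - r) * t + r * (1 - t)) by ring] at h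
  exact h

end InterpolationalPath

theorem theorem2p1 {H : Type*} [NormedAddCommGroup H] [InnerProductSpace ℂ H] [CompleteSpace H]
    (m : ℕ) (A B : Fin m → H →L[ℂ] H)
    (hA : ∀ j, IsStrictlyPositive (A j)) (hB : ∀ j, IsStrictlyPositive (B j))
    (σ : (H →L[ℂ] H) → (H →L[ℂ] H) → (H →L[ℂ] H)) (hσ : IsOperatorMean σ) :
    (∑ j, geometricMean (A j) (B j) ≤
        geometricMean (∑ j, σ (A j) (B j)) (∑ j, dualMean σ (A j) (B j)) ∧
      geometricMean (∑ j, σ (A j) (B j)) (∑ j, dualMean σ (A j) (B j)) ≤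
        geometricMean (∑ j, A j) (∑ j, B j)) ∧
    ∀ τ : ℝ → (H →L[ℂ] H) → (H →L[ℂ] H) → (H →L[ℂ] H),
      IsInterpolationalPath σ τ →
      (∀ t ∈ Set.Icc (0 : ℝ) 1, ∀ X Y : H →L[ℂ] H, IsStrictlyPositive X → IsStrictlyPositive Y →
        dualMean (τ t) X Y = τ (1 - t) X Y) →
      ∀ t ∈ Set.Icc (0 : ℝ) 1, ∀ s ∈ Set.uIcc t (1 - t),
        geometricMean (∑ j, τ s (A j) (B j)) (∑ j, τ (1 - s) (A j) (B j)) ≤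
          geometricMean (∑ j, τ t (A j) (B j)) (∑ j, τ (1 - t) (A j) (B j)) := by
  rcases subsingleton_or_nontrivial H with h | h
  · exact ⟨⟨(Subsingleton.elim _ _).le, (Subsingleton.elim _ _).le⟩,
      fun _ _ _ _ _ _ _ => (Subsingleton.elim _ _).le⟩
  rcases Nat.eq_zero_or_pos m with rfl | hm
  · have h0 : geometricMean (0 : H →L[ℂ] H) 0 = 0 := by
      rw [geometricMean, show (0 : H →L[ℂ] H) ^ (1 / 2 : ℝ) = 0 from CFC.zero_rpow (by norm_num),
        mul_zero]
    simp [h0]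
  · have : Nonempty (Fin m) := ⟨⟨0, hm⟩⟩
    exact ⟨hσ.geometricMean_sum_bounds Finset.univ_nonempty hA hB,
      fun τ hτ hdual t ht s hs =>
        hτ.geometricMean_sum_le hdual Finset.univ_nonempty hA hB ht hs⟩
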